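/- Let $\mu$ be normalized Haar measure (arc length) on the unit circle $\mathbb{T}$, let $1\le p<\infty$, and let $\lambda$ be a probability measure on $\mathbb{T}$ that is mutually absolutely continuous with $\mu$. Put $g=d\lambda/d\mu$ and assume $\int_{\mathbb{T}}|\log g|\,d\mu=\infty$. Let $H^p(\mu)$ be the closure in $L^p(\mu)$ of the polynomials in the coordinate function $z$, and let $M_0=g^{-1/p}H^p(\mu)=\{g^{-1/p}f : f\in H^p(\mu)\}\subseteq L^p(\lambda)$. Then a linear subspace $M$ of $L^p(\lambda)$ is closed and satisfies $zM\subseteq M$ if and only if (1) $M=\varphi M_0$ for some measurable function $\varphi$ on $\mathbb{T}$ with $|\varphi|=1$ almost everywhere, or (2) $M=\chi_E L^p(\lambda)$ for some Borel set $E\subseteq\mathbb{T}$. -/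

import Mathlib

open MeasureTheory
open scoped ENNReal

noncomputable section

namespace BeurlingCircle

instance : MeasurableSpace Circle := borel Circle

instance : BorelSpace Circle := ⟨rfl⟩

/-- Normalized Haar measure (normalized arc length) on the unit circle. -/
def haarCircle : Measure Circle := Measure.haarMeasure ⊤

instance : IsProbabilityMeasure haarCircle :=
  ⟨by simpa [haarCircle] using
    Measure.haarMeasure_self (K₀ := (⊤ : TopologicalSpace.PositiveCompacts Circle))⟩

/-- `mulSubspace w hac S` is the subspace `w • S = {w h : h ∈ S}` of `L^p(lam)`, for a function `w`
on the circle and a subspace `S` of `L^p(ν)`; the products are taken almost everywhere, which is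
meaningful because `lam ≪ ν`. (In all uses below, every product `w h` does lie in `L^p(lam)`.) -/
def mulSubspace {p : ℝ≥0∞} {lam ν : Measure Circle} (w : Circle → ℂ) (hac : lam ≪ ν)
    (S : Submodule ℂ (Lp ℂ p ν)) : Submodule ℂ (Lp ℂ p lam) where
  carrier := {f | ∃ h ∈ S, f =ᵐ[lam] fun x => w x * h x}
  zero_mem' := by
    refine ⟨0, S.zero_mem, ?_⟩
    filter_upwards [Lp.coeFn_zero ℂ p lam, hac.ae_le (Lp.coeFn_zero ℂ p ν)] with x h1 h2
    rw [h1, h2]; simp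
  add_mem' := by
    rintro f₁ f₂ ⟨h₁, hS₁, e₁⟩ ⟨h₂, hS₂, e₂⟩
    refine ⟨h₁ + h₂, S.add_mem hS₁ hS₂, ?_⟩
    filter_upwards [e₁, e₂, Lp.coeFn_add f₁ f₂, hac.ae_le (Lp.coeFn_add h₁ h₂)] with x a b c d
    rw [c, d, Pi.add_apply, Pi.add_apply, a, b, mul_add]
  smul_mem' := by
    rintro k f ⟨h, hS, e⟩
    refine ⟨k • h, S.smul_mem k hS, ?_⟩
    filter_upwards [e, Lp.coeFn_smul k f, hac.ae_le (Lp.coeFn_smul k h)] with x a b c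
    rw [b, c, Pi.smul_apply, Pi.smul_apply, a, smul_eq_mul, smul_eq_mul, mul_left_comm]

/-- The coordinate function `z` on the circle. -/
def coordinate : C(Circle, ℂ) := ⟨fun z => (z : ℂ), by fun_prop⟩

/-- `H^p(ν)`: the closure in `L^p(ν)` of the polynomials in `z`. -/
def hardySpace (p : ℝ≥0∞) [Fact (1 ≤ p)] (ν : Measure Circle) [IsFiniteMeasure ν] :
    Submodule ℂ (Lp ℂ p ν) :=
  (Submodule.span ℂ
    (Set.range fun n : ℕ => ContinuousMap.toLp p ν ℂ (coordinate ^ n))).topologicalClosure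

/-- The density `g = d lam / dμ` with respect to normalized Haar measure. -/
def density (lam : Measure Circle) (x : Circle) : ℝ := (lam.rnDeriv haarCircle x).toReal

/-- The subspace `M₀ = g^{-1/p} H^p(μ)` of `L^p(lam)`, where `g = d lam / dμ`. -/
def weightedHardy (p : ℝ≥0∞) [Fact (1 ≤ p)] (lam : Measure Circle) (hac : lam ≪ haarCircle) :
    Submodule ℂ (Lp ℂ p lam) :=
  mulSubspace (fun x => ((density lam x ^ (-(1 / p.toReal)) : ℝ) : ℂ)) hac
    (hardySpace p haarCircle)

/-- A measurable function on the circle that has modulus one almost everywhere. -/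
def IsUnimodular (φ : Circle → ℂ) : Prop :=
  Measurable φ ∧ ∀ᵐ x ∂haarCircle, ‖φ x‖ = 1

end BeurlingCircle

end

/-! Since $g>0$ almost everywhere, multiplication by $g^{-1/p}$ is a linear isometry of $L^p(\mu)$
onto $L^p(\lambda)$. It commutes with every pointwise multiplication and carries $H^p(\mu)$ to
$M_0$, so the claim is the Beurling–Helson theorem for $L^p(\mu)$, transported.

For $p=2$ the proof is geometric. If $zN=N$, the projection of $1$ onto $N$ is an indicator $\chi_E$
and $N=\chi_E L^2$. Otherwise a unit vector of $N$ orthogonal to $zN$ is orthogonal to its own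
forward shifts. Its squared modulus then has only a constant Fourier term, so it is unimodular and
generates $N$ (`beurling_helson_two`).

The passage to other $p$ rests on `exists_L2_generator`: for $q\le 2$, each $k\in L^q$ generates the
same invariant subspace as some $L^2$ function. Indeed $k=Uh$ with $h$ outer of modulus
$\max(1,|k|)^{q/2}$, and since $h$ and $1$ generate the same subspace of $L^2$, $k$ and $U$ generate
the same subspace of $L^q$. The outer function comes from the $L^2$ theorem, applied to the
invariant subspace generated by the prescribed modulus (`exists_outer`).

Hence for $p\le 2$ an invariant subspace is determined by its part in $L^2$. For $p\ge 2$ it is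
recovered from its $L^2$-closure: an annihilating function in $L^q$, $q\le 2$, can be traded for one
in $L^2$, which annihilates that closure as well. The annihilating functions come from nearest
points, which exist by Clarkson's inequality. -/

noncomputable section

namespace BeurlingCircle

open Filter Topology

/-! ### Separation in $L^p$, $p\ge 2$, by nearest points -/

section Annihilator

/-- **Clarkson's inequality** for exponents at least two, pointwise form. -/
lemma norm_add_rpow_add_norm_sub_rpow_le {E : Type*} [NormedAddCommGroup E]
    [InnerProductSpace ℝ E] {r : ℝ} (hr : 2 ≤ r) (a b : E) :
    ‖a + b‖ ^ r + ‖a - b‖ ^ r ≤ 2 ^ (r - 1) * (‖a‖ ^ r + ‖b‖ ^ r) := by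
  -- In terms of squared norms and $s=r/2\ge 1$: superadditivity of $x^s$ bounds the left side, the
  -- parallelogram law evaluates the sum, and convexity of $x^s$ bounds the result.
  have hs : 1 ≤ r / 2 := by linarith
  have key : ∀ x : E, ‖x‖ ^ r = (‖x‖ ^ 2) ^ (r / 2) := fun x => by
    rw [← Real.rpow_natCast, ← Real.rpow_mul (norm_nonneg x)]
    congr 1
    push_cast
    ring
  have hpar : ‖a + b‖ ^ 2 + ‖a - b‖ ^ 2 = 2 * (‖a‖ ^ 2 + ‖b‖ ^ 2) := by
    have := parallelogram_law_with_norm ℝ a b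
    nlinarith
  have h2 : (‖a‖ ^ 2 + ‖b‖ ^ 2) ^ (r / 2) ≤
      2 ^ (r / 2 - 1) * ((‖a‖ ^ 2) ^ (r / 2) + (‖b‖ ^ 2) ^ (r / 2)) := by
    have := NNReal.rpow_add_le_mul_rpow_add_rpow (‖a‖₊ ^ 2) (‖b‖₊ ^ 2) hs
    exact_mod_cast this
  calc ‖a + b‖ ^ r + ‖a - b‖ ^ r
      = (‖a + b‖ ^ 2) ^ (r / 2) + (‖a - b‖ ^ 2) ^ (r / 2) := by rw [key, key (a - b)]
    _ ≤ (‖a + b‖ ^ 2 + ‖a - b‖ ^ 2) ^ (r / 2) :=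
        Real.add_rpow_le_rpow_add (by positivity) (by positivity) hs
    _ = 2 ^ (r / 2) * (‖a‖ ^ 2 + ‖b‖ ^ 2) ^ (r / 2) := by
        rw [hpar, Real.mul_rpow (by norm_num) (by positivity)]
    _ ≤ 2 ^ (r / 2) * (2 ^ (r / 2 - 1) * ((‖a‖ ^ 2) ^ (r / 2) + (‖b‖ ^ 2) ^ (r / 2))) := by
        gcongr
    _ = 2 ^ (r - 1) * (‖a‖ ^ r + ‖b‖ ^ r) := by
        rw [← mul_assoc, ← Real.rpow_add (by norm_num), key, key b]
        congr 2
        ring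

variable {α : Type*} {m : MeasurableSpace α} {ν : Measure α} {p : ℝ≥0∞} [hp1 : Fact (1 ≤ p)]

lemma norm_rpow_eq_integral (hp : p ≠ ⊤) (f : Lp ℂ p ν) :
    ‖f‖ ^ p.toReal = ∫ x, ‖f x‖ ^ p.toReal ∂ν := by
  have hp0 : p ≠ 0 := (zero_lt_one.trans_le hp1.out).ne'
  have hr : 0 < p.toReal := ENNReal.toReal_pos hp0 hp
  have hnn : 0 ≤ ∫ x, ‖f x‖ ^ p.toReal ∂ν := integral_nonneg fun x => by positivity
  rw [Lp.norm_def, (Lp.memLp f).eLpNorm_eq_integral_rpow_norm hp0 hp,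
    ENNReal.toReal_ofReal (by positivity), ← Real.rpow_mul hnn, inv_mul_cancel₀ hr.ne',
    Real.rpow_one]

lemma integrable_norm_rpow (hp : p ≠ ⊤) (f : Lp ℂ p ν) :
    Integrable (fun x => ‖f x‖ ^ p.toReal) ν :=
  (Lp.memLp f).integrable_norm_rpow (zero_lt_one.trans_le hp1.out).ne' hp

/-- **Clarkson's inequality** in `L^p` for `2 ≤ p < ∞`. -/
lemma Lp_norm_add_rpow_add_norm_sub_rpow_le (hp2 : 2 ≤ p) (hp : p ≠ ⊤) (f g : Lp ℂ p ν) :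
    ‖f + g‖ ^ p.toReal + ‖f - g‖ ^ p.toReal ≤
      2 ^ (p.toReal - 1) * (‖f‖ ^ p.toReal + ‖g‖ ^ p.toReal) := by
  have hr : 2 ≤ p.toReal := by simpa using ENNReal.toReal_mono hp hp2
  simp only [norm_rpow_eq_integral hp]
  rw [← integral_add (integrable_norm_rpow hp _) (integrable_norm_rpow hp _),
    ← integral_add (integrable_norm_rpow hp _) (integrable_norm_rpow hp _),
    ← integral_const_mul]
  refine integral_mono_ae ((integrable_norm_rpow hp _).add (integrable_norm_rpow hp _))
    (((integrable_norm_rpow hp _).add (integrable_norm_rpow hp _)).const_mul _) ?_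
  filter_upwards [Lp.coeFn_add f g, Lp.coeFn_sub f g] with x h1 h2
  rw [h1, h2]
  exact norm_add_rpow_add_norm_sub_rpow_le hr (f x) (g x)

/-- A space satisfying Clarkson's inequality has nearest points in closed subspaces. -/
lemma exists_nearest_of_clarkson {E : Type*} [NormedAddCommGroup E] [NormedSpace ℂ E]
    [CompleteSpace E] {r : ℝ} (hr : 1 < r)
    (hE : ∀ u v : E, ‖u + v‖ ^ r + ‖u - v‖ ^ r ≤ 2 ^ (r - 1) * (‖u‖ ^ r + ‖v‖ ^ r))
    (M : Submodule ℂ E) (hM : IsClosed (M : Set E)) (f : E) :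
    ∃ y ∈ M, ∀ z ∈ M, ‖f - y‖ ≤ ‖f - z‖ := by
  have hr0 : 0 < r := by linarith
  have hne : (M : Set E).Nonempty := ⟨0, M.zero_mem⟩
  set d := Metric.infDist f M with hd
  have hd0 : 0 ≤ d := Metric.infDist_nonneg
  have hdle : ∀ z ∈ M, d ≤ ‖f - z‖ := fun z hz => by
    rw [← dist_eq_norm]
    exact Metric.infDist_le_dist_of_mem hz
  have hex : ∀ n : ℕ, ∃ y ∈ M, ‖f - y‖ < d + 1 / ((n : ℝ) + 1) := fun n => by
    obtain ⟨y, hy, h⟩ := (Metric.infDist_lt_iff (x := f) hne).1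
      (show Metric.infDist f M < d + 1 / ((n : ℝ) + 1) from
        lt_add_of_pos_right _ (by positivity))
    exact ⟨y, hy, by rwa [dist_eq_norm] at h⟩
  choose y hyM hy using hex
  have hlim : Tendsto (fun n : ℕ => d + 1 / ((n : ℝ) + 1)) atTop (𝓝 d) := by
    simpa using (tendsto_one_div_add_atTop_nhds_zero_nat (𝕜 := ℝ)).const_add d
  have hcau : CauchySeq y := by
    -- This modulus is what Clarkson's inequality gives for `f - y n` and `f - y k`: their sum has
    -- norm at least $2d$, because the midpoint of `y n` and `y k` lies in `M`.
    have hlim2 : Tendsto (fun n : ℕ => (2 ^ r * ((d + 1 / ((n : ℝ) + 1)) ^ r - d ^ r)) ^ r⁻¹)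
        atTop (𝓝 0) := by
      have h := ((hlim.rpow_const (p := r) (Or.inr hr0.le)).sub_const (d ^ r)).const_mul (2 ^ r)
      have h' := h.rpow_const (p := r⁻¹) (Or.inr (by positivity))
      simpa [Real.zero_rpow (inv_ne_zero hr0.ne')] using h'
    refine cauchySeq_of_le_tendsto_0 _ (fun n k N hn hk => ?_) hlim2
    have hmono : ∀ j : ℕ, N ≤ j → ‖f - y j‖ ≤ d + 1 / ((N : ℝ) + 1) := fun j hj =>
      (hy j).le.trans (by gcongr)
    have hmid : 2 * d ≤ ‖(f - y n) + (f - y k)‖ := by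
      have h := hdle _ (M.smul_mem (1 / 2 : ℂ) (M.add_mem (hyM n) (hyM k)))
      have h2 : (f - y n) + (f - y k) = (2 : ℂ) • (f - (1 / 2 : ℂ) • (y n + y k)) := by
        module
      rw [h2, norm_smul]
      simpa using h
    have hsub : (f - y n) - (f - y k) = y k - y n := by abel
    have hC := hE (f - y n) (f - y k)
    rw [hsub] at hC
    have h1 : (2 * d) ^ r ≤ ‖(f - y n) + (f - y k)‖ ^ r := by gcongr
    have h2 : ‖f - y n‖ ^ r ≤ (d + 1 / ((N : ℝ) + 1)) ^ r := by
      gcongr; exact hmono n hn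
    have h3 : ‖f - y k‖ ^ r ≤ (d + 1 / ((N : ℝ) + 1)) ^ r := by
      gcongr; exact hmono k hk
    have h4 : (2 : ℝ) ^ r = 2 * 2 ^ (r - 1) := by
      rw [Real.rpow_sub_one (by norm_num)]; ring
    rw [Real.mul_rpow (by norm_num) hd0] at h1
    have h5 : (2 : ℝ) ^ (r - 1) * (‖f - y n‖ ^ r + ‖f - y k‖ ^ r) ≤
        2 ^ (r - 1) * ((d + 1 / ((N : ℝ) + 1)) ^ r + (d + 1 / ((N : ℝ) + 1)) ^ r) := by
      gcongr
    have h6 : ‖y k - y n‖ ^ r ≤ 2 ^ r * ((d + 1 / ((N : ℝ) + 1)) ^ r - d ^ r) := by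
      rw [h4] at h1 ⊢
      linarith
    rw [dist_comm, dist_eq_norm]
    calc ‖y k - y n‖ = (‖y k - y n‖ ^ r) ^ r⁻¹ := by
          rw [← Real.rpow_mul (norm_nonneg _), mul_inv_cancel₀ hr0.ne', Real.rpow_one]
      _ ≤ _ := by gcongr
  obtain ⟨y₀, hy₀⟩ := cauchySeq_tendsto_of_complete hcau
  refine ⟨y₀, hM.mem_of_tendsto hy₀ (Eventually.of_forall hyM), fun z hz => ?_⟩
  refine le_trans ?_ (hdle z hz)
  exact le_of_tendsto_of_tendsto' (tendsto_const_nhds.sub hy₀).norm hlim fun n => (hy n).le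

/-- First variation of the `L^p` norm at a minimum along the line `F + t w`. -/
lemma integral_norm_rpow_mul_inner_eq_zero (hp2 : 2 ≤ p) (hp : p ≠ ⊤) (F w : Lp ℂ p ν)
    (hmin : ∀ t : ℝ, ‖F‖ ≤ ‖F + t • w‖) :
    ∫ x, ‖F x‖ ^ (p.toReal - 2) * inner ℝ (F x) (w x) ∂ν = 0 := by
  have hr : 2 ≤ p.toReal := by simpa using ENNReal.toReal_mono hp hp2
  have hp0 : p ≠ 0 := (zero_lt_one.trans_le hp1.out).ne'
  set r := p.toReal with hrdef
  have hmemF := Lp.memLp F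
  have hmemw := Lp.memLp w
  -- For $|t|\le 1$ the derivative of the integrand is at most $r(|F|+|w|)^{r-2}(|F|+|w|)^2$; the
  -- exponent $r-2$ is nonnegative, so this bound is uniform in $t$.
  have hdom : Integrable (fun x => r * ‖‖F x‖ + ‖w x‖‖ ^ r) ν :=
    ((hmemF.norm.add hmemw.norm).integrable_norm_rpow hp0 hp).const_mul r
  have hder := hasDerivAt_integral_of_dominated_loc_of_deriv_le (μ := ν) (x₀ := (0 : ℝ))
    (s := Metric.ball 0 1) (F := fun t x => ‖F x + t • w x‖ ^ r)
    (F' := fun t x => r * ‖F x + t • w x‖ ^ (r - 2) * inner ℝ (F x + t • w x) (w x))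
    (bound := fun x => r * ‖‖F x‖ + ‖w x‖‖ ^ r) (Metric.ball_mem_nhds _ one_pos)
    (Eventually.of_forall fun t => by
      exact ((hmemF.1.add (hmemw.1.const_smul t)).norm.aemeasurable.pow_const r).aestronglyMeasurable)
    (by simpa using hmemF.integrable_norm_rpow hp0 hp)
    (by
      have h1 : AEStronglyMeasurable (fun x => ‖F x‖ ^ (r - 2)) ν :=
        (hmemF.1.norm.aemeasurable.pow_const _).aestronglyMeasurable
      have h2 : AEStronglyMeasurable (fun x => inner ℝ (F x) (w x)) ν := hmemF.1.inner hmemw.1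
      simp only [zero_smul, add_zero]
      exact (h1.const_mul r).mul h2)
    (Eventually.of_forall fun x t ht => by
      have ht' : |t| ≤ 1 := by
        have := Metric.mem_ball.1 ht
        rw [Real.dist_eq, sub_zero] at this
        exact this.le
      have hn : ‖F x + t • w x‖ ≤ ‖F x‖ + ‖w x‖ := by
        refine (norm_add_le _ _).trans ?_
        rw [norm_smul, Real.norm_eq_abs]
        nlinarith [norm_nonneg (w x)]
      have hin : |inner ℝ (F x + t • w x) (w x)| ≤ (‖F x‖ + ‖w x‖) * (‖F x‖ + ‖w x‖) := by
        refine (abs_real_inner_le_norm _ _).trans ?_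
        gcongr
        linarith [norm_nonneg (F x)]
      rw [norm_mul, norm_mul, Real.norm_eq_abs, Real.norm_eq_abs, Real.norm_eq_abs, abs_of_nonneg
        (by linarith : 0 ≤ r), abs_of_nonneg (by positivity), Real.norm_eq_abs,
        abs_of_nonneg (by positivity : 0 ≤ ‖F x‖ + ‖w x‖), mul_assoc]
      refine mul_le_mul_of_nonneg_left ?_ (by linarith)
      calc _ ≤ (‖F x‖ + ‖w x‖) ^ (r - 2) * ((‖F x‖ + ‖w x‖) * (‖F x‖ + ‖w x‖)) := by
            gcongr
        _ = (‖F x‖ + ‖w x‖) ^ r := by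
            rw [← sq, ← Real.rpow_natCast, ← Real.rpow_add_of_nonneg (by positivity)
              (by linarith) (by norm_num)]
            congr 1
            push_cast
            ring)
    hdom
    (Eventually.of_forall fun x t _ => by
      have h1 : HasDerivAt (fun t : ℝ => F x + t • w x) (w x) t := by
        simpa using ((hasDerivAt_id t).smul_const (w x)).const_add (F x)
      have h2 := (hasFDerivAt_norm_rpow (F x + t • w x) (by linarith : 1 < r)).comp_hasDerivAt t h1
      exact h2)
  have hlm : IsLocalMin (fun t : ℝ => ∫ x, ‖F x + t • w x‖ ^ r ∂ν) 0 := by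
    refine Eventually.of_forall fun t => ?_
    have hI : ∀ t : ℝ, ∫ x, ‖F x + t • w x‖ ^ r ∂ν = ‖F + t • w‖ ^ r := fun t => by
      rw [hrdef, norm_rpow_eq_integral hp]
      refine integral_congr_ae ?_
      filter_upwards [Lp.coeFn_add F (t • w), Lp.coeFn_smul t w] with x h1 h2
      rw [h1, Pi.add_apply, h2, Pi.smul_apply]
    show (∫ x, ‖F x + (0 : ℝ) • w x‖ ^ r ∂ν) ≤ ∫ x, ‖F x + t • w x‖ ^ r ∂ν
    rw [hI, hI]
    refine Real.rpow_le_rpow (norm_nonneg _) ?_ (by linarith)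
    simpa using hmin t
  have h0 := hlm.hasDerivAt_eq_zero hder.2
  simp only [zero_smul, add_zero, mul_assoc] at h0
  rw [integral_const_mul] at h0
  exact (mul_eq_zero.1 h0).resolve_left (by linarith)

/-- A point outside a closed subspace of `L^p`, `2 ≤ p < ∞`, is separated from it by a function in
the conjugate `L^q`. -/
theorem exists_memLp_annihilating (hp2 : 2 ≤ p) (hp : p ≠ ⊤) {q : ℝ≥0∞} [hpq : p.HolderConjugate q]
    (M : Submodule ℂ (Lp ℂ p ν)) (hM : IsClosed (M : Set (Lp ℂ p ν))) (f : Lp ℂ p ν)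
    (hf : f ∉ M) :
    ∃ k : α → ℂ, MemLp k q ν ∧ (∀ w ∈ M, ∫ x, k x * w x ∂ν = 0) ∧ ∫ x, k x * f x ∂ν ≠ 0 := by
  have hr : 2 ≤ p.toReal := by simpa using ENNReal.toReal_mono hp hp2
  have hp0 : p ≠ 0 := (zero_lt_one.trans_le hp1.out).ne'
  obtain ⟨y, hyM, hy⟩ := exists_nearest_of_clarkson (by linarith : 1 < p.toReal)
    (Lp_norm_add_rpow_add_norm_sub_rpow_le hp2 hp) M hM f
  set F := f - y with hF
  set r := p.toReal with hrdef
  have hF0 : F ≠ 0 := fun h => hf (by rw [sub_eq_zero.1 h]; exact hyM)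
  -- Up to conjugation and the factor $r$, the gradient of $\|\cdot\|^r$ at the minimal vector $F$.
  set k : α → ℂ := fun x => ((‖F x‖ ^ (r - 2) : ℝ) : ℂ) * (starRingEnd ℂ) (F x) with hk
  have hmemF := Lp.memLp F
  have hknorm : ∀ x, ‖k x‖ = ‖F x‖ ^ (r - 1) := fun x => by
    rw [hk]
    simp only [norm_mul, Complex.norm_real, RCLike.norm_conj, Real.norm_eq_abs]
    rw [abs_of_nonneg (by positivity), ← Real.rpow_add_one' (norm_nonneg _) (by linarith)]
    congr 1
    ring
  have hkmeas : AEStronglyMeasurable k ν := by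
    refine AEStronglyMeasurable.mul ?_ (RCLike.continuous_conj.comp_aestronglyMeasurable hmemF.1)
    exact Complex.continuous_ofReal.comp_aestronglyMeasurable
      (hmemF.1.norm.aemeasurable.pow_const _).aestronglyMeasurable
  have hkq : MemLp k q ν := by
    -- $|k|^{q}=|F|^{(r-1)q}=|F|^r$, as $q=r/(r-1)$.
    have hq : p / ENNReal.ofReal (r - 1) = q := by
      have hc := hpq.conjExponent_eq
      rw [← hc, ENNReal.conjExponent]
      have hpr : p = ENNReal.ofReal r := (ENNReal.ofReal_toReal hp).symm
      have h1 : p - 1 = ENNReal.ofReal (r - 1) := by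
        rw [hpr, ← ENNReal.ofReal_one, ENNReal.ofReal_sub _ zero_le_one]
      rw [h1, hpr]
      have hpos : 0 < r - 1 := by linarith
      rw [← ENNReal.ofReal_div_of_pos hpos, ← ENNReal.ofReal_inv_of_pos hpos, ← ENNReal.ofReal_one,
        ← ENNReal.ofReal_add zero_le_one (by positivity)]
      congr 1
      field_simp
      ring
    have h := hmemF.norm_rpow_div (ENNReal.ofReal (r - 1))
    rw [hq, ENNReal.toReal_ofReal (by linarith)] at h
    exact h.mono hkmeas (Eventually.of_forall fun x => by
      rw [hknorm, Real.norm_eq_abs]; exact le_abs_self _)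
  have hint : ∀ w : Lp ℂ p ν, Integrable (fun x => k x * w x) ν := fun w =>
    memLp_one_iff_integrable.1 ((Lp.memLp w).mul' hkq)
  have hre : ∀ w ∈ M, (∫ x, k x * w x ∂ν).re = 0 := fun w hw => by
    have h := integral_norm_rpow_mul_inner_eq_zero hp2 hp F w fun t => by
      have h1 := hy (y - t • w) (M.sub_mem hyM (M.smul_of_tower_mem t hw))
      rwa [show f - (y - t • w) = F + t • w by rw [hF]; abel] at h1
    rw [← RCLike.re_eq_complex_re, ← integral_re (hint w), ← h]
    refine integral_congr_ae (Eventually.of_forall fun x => ?_)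
    simp only [hk, RCLike.re_eq_complex_re, mul_assoc, Complex.re_ofReal_mul]
    rw [Complex.inner, mul_comm (w x)]
  have hzero : ∀ w ∈ M, ∫ x, k x * w x ∂ν = 0 := fun w hw => by
    refine Complex.ext (hre w hw) ?_
    -- The first variation controls real parts only; `M` being complex, testing with $iw$ gives the
    -- imaginary part.
    have h := hre (Complex.I • w) (M.smul_mem _ hw)
    have h2 : ∫ x, k x * (Complex.I • w : Lp ℂ p ν) x ∂ν = Complex.I * ∫ x, k x * w x ∂ν := by
      rw [← integral_const_mul]
      refine integral_congr_ae ?_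
      filter_upwards [Lp.coeFn_smul Complex.I w] with x hx
      rw [hx, Pi.smul_apply, smul_eq_mul]
      ring
    rw [h2] at h
    simpa using h
  refine ⟨k, hkq, hzero, fun h0 => hF0 ?_⟩
  -- If $k$ also killed $f$ it would kill $F=f-y$, yet $\int kF=\|F\|^r$.
  have h1 : ∫ x, k x * F x ∂ν = 0 := by
    have : ∫ x, k x * F x ∂ν = (∫ x, k x * f x ∂ν) - ∫ x, k x * y x ∂ν := by
      rw [← integral_sub (hint f) (hint y)]
      refine integral_congr_ae ?_
      filter_upwards [Lp.coeFn_sub f y] with x hx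
      rw [hF, hx, Pi.sub_apply, mul_sub]
    rw [this, h0, hzero y hyM, sub_zero]
  have h2 : ∫ x, k x * F x ∂ν = ((∫ x, ‖F x‖ ^ r ∂ν : ℝ) : ℂ) := by
    rw [← integral_complex_ofReal]
    refine integral_congr_ae (Eventually.of_forall fun x => ?_)
    simp only [hk, mul_assoc]
    rw [mul_comm ((starRingEnd ℂ) (F x)), Complex.mul_conj', ← Complex.ofReal_pow,
      ← Complex.ofReal_mul, ← Real.rpow_natCast, ← Real.rpow_add_of_nonneg (norm_nonneg _)
        (by linarith) (by norm_num)]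
    congr 3
    push_cast
    ring
  rw [h2, ← norm_rpow_eq_integral hp, Complex.ofReal_eq_zero, Real.rpow_eq_zero (norm_nonneg _)
    (by positivity)] at h1
  exact norm_eq_zero.1 h1

end Annihilator

/-! ### Multiplication operators and inclusions between $L^p$ spaces -/

section Operators

variable {α : Type*} {m : MeasurableSpace α} {ν : Measure α} {p q r s : ℝ≥0∞}

/-- Multiplication by a function in `L^s`, as an operator from `L^q` to `L^r`. -/
def mulOp [Fact (1 ≤ s)] [Fact (1 ≤ q)] [Fact (1 ≤ r)] [ENNReal.HolderTriple s q r]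
    (w : Lp ℂ s ν) : Lp ℂ q ν →L[ℂ] Lp ℂ r ν :=
  (ContinuousLinearMap.mul ℂ ℂ).holderL ν s q r w

lemma coeFn_mulOp [Fact (1 ≤ s)] [Fact (1 ≤ q)] [Fact (1 ≤ r)] [ENNReal.HolderTriple s q r]
    (w : Lp ℂ s ν) (f : Lp ℂ q ν) : (mulOp w f : Lp ℂ r ν) =ᵐ[ν] fun x => w x * f x := by
  exact (ContinuousLinearMap.mul ℂ ℂ).coeFn_holder (r := r) w f

variable [Fact (1 ≤ p)] [Fact (1 ≤ q)]

/-- The inclusion of `L^q` into `L^p` for `p ≤ q` over a probability space. -/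
def incl [IsProbabilityMeasure ν] (h : p ≤ q) : Lp ℂ q ν →L[ℂ] Lp ℂ p ν :=
  LinearMap.mkContinuous
    { toFun := fun f => ((Lp.memLp f).mono_exponent h).toLp f
      map_add' := fun f g => by
        rw [← MemLp.toLp_add]
        exact MemLp.toLp_congr _ _ (Lp.coeFn_add f g)
      map_smul' := fun c f => by
        rw [RingHom.id_apply, ← MemLp.toLp_const_smul]
        exact MemLp.toLp_congr _ _ (Lp.coeFn_smul c f) } 1 fun f => by
    simp only [LinearMap.coe_mk, AddHom.coe_mk, one_mul]
    rw [Lp.norm_toLp, Lp.norm_def]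
    exact ENNReal.toReal_mono (Lp.eLpNorm_ne_top f)
      (eLpNorm_le_eLpNorm_of_exponent_le h (Lp.aestronglyMeasurable f))

lemma coeFn_incl [IsProbabilityMeasure ν] (h : p ≤ q) (f : Lp ℂ q ν) :
    (incl h f : Lp ℂ p ν) =ᵐ[ν] f :=
  MemLp.coeFn_toLp ((Lp.memLp f).mono_exponent h)

end Operators

/-! ### Characters and uniqueness of Fourier coefficients -/

section Characters

/-- The character `z ↦ z ^ n` of the circle, as a complex function. -/
def character (n : ℤ) : C(Circle, ℂ) := ⟨fun x => ((x ^ n : Circle) : ℂ),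
  coordinate.continuous.comp (continuous_zpow n)⟩

@[simp] lemma character_apply (n : ℤ) (x : Circle) : character n x = ((x ^ n : Circle) : ℂ) := rfl

lemma norm_character (n : ℤ) (x : Circle) : ‖character n x‖ = 1 := Circle.norm_coe _

lemma character_add (m n : ℤ) (x : Circle) :
    character (m + n) x = character m x * character n x := by
  simp [zpow_add₀]

lemma conj_character (n : ℤ) (x : Circle) :
    (starRingEnd ℂ) (character n x) = character (-n) x := by
  rw [character_apply, character_apply, ← Circle.coe_inv_eq_conj, zpow_neg]

lemma coordinate_pow_apply (n : ℕ) (x : Circle) : (coordinate ^ n) x = character n x := by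
  simp only [ContinuousMap.coe_pow, Pi.pow_apply, character_apply, zpow_natCast, Circle.coe_pow]
  rfl

/-- Stone–Weierstrass. The characters are closed under products and conjugation, so the algebra they
generate is just their span. -/
lemma span_character_closure_eq_top :
    (Submodule.span ℂ (Set.range character)).topologicalClosure = ⊤ := by
  let A : StarSubalgebra ℂ C(Circle, ℂ) :=
    { Algebra.adjoin ℂ (Set.range character) with
      star_mem' := by
        change Algebra.adjoin ℂ (Set.range character) ≤
          star (Algebra.adjoin ℂ (Set.range character))
        refine Algebra.adjoin_le ?_
        rintro - ⟨n, rfl⟩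
        refine Algebra.subset_adjoin ⟨-n, ?_⟩
        ext x
        exact (conj_character n x).symm }
  have hsep : A.SeparatesPoints := by
    intro x y hxy
    refine ⟨_, ⟨character 1, Algebra.subset_adjoin ⟨1, rfl⟩, rfl⟩, ?_⟩
    simpa [Circle.ext_iff] using hxy
  have hA := ContinuousMap.starSubalgebra_topologicalClosure_eq_top_of_separatesPoints A hsep
  have hspan : Subalgebra.toSubmodule A.toSubalgebra = Submodule.span ℂ (Set.range character) := by
    refine Algebra.adjoin_eq_span_of_subset (R := ℂ) ?_
    refine Set.Subset.trans (fun x hx => ?_) Submodule.subset_span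
    have hx' : ∀ x ∈ Submonoid.closure (Set.range character), x ∈ Set.range character := by
      intro x hx
      induction hx using Submonoid.closure_induction with
      | mem x hx => exact hx
      | one => exact ⟨0, by ext; simp⟩
      | mul x y _ _ hx hy =>
        obtain ⟨m, rfl⟩ := hx
        obtain ⟨n, rfl⟩ := hy
        exact ⟨m + n, by ext x; exact character_add m n x⟩
    exact hx' x hx
  rw [← hspan]
  exact congr_arg (Subalgebra.toSubmodule <| StarSubalgebra.toSubalgebra ·) hA

instance : haarCircle.IsMulLeftInvariant := by
  unfold haarCircle; infer_instance

lemma integral_character_of_ne {n : ℤ} (hn : n ≠ 0) : ∫ x, character n x ∂haarCircle = 0 := by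
  -- Chosen so that $a^n=-1$: translation by $a$ changes the sign of the integrand but not the
  -- integral.
  set a : Circle := Circle.exp (Real.pi / n) with ha
  have han : ((a ^ n : Circle) : ℂ) = -1 := by
    have hn' : (n : ℂ) ≠ 0 := by exact_mod_cast hn
    rw [ha, ← Circle.exp_intCast_mul, Circle.coe_exp]
    push_cast
    rw [mul_div_cancel₀ _ hn', Complex.exp_pi_mul_I]
  have h := integral_mul_left_eq_self (μ := haarCircle) (fun x => character n x) a
  have h2 : ∀ x : Circle, character n (a * x) = -1 * character n x := fun x => by
    rw [character_apply, mul_zpow, Circle.coe_mul, han]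
    rfl
  simp only [h2] at h
  rw [integral_const_mul] at h
  have : (2 : ℂ) * ∫ x, character n x ∂haarCircle = 0 := by linear_combination -h
  simpa using this

/-- An integrable function whose Fourier coefficients all vanish is zero. -/
theorem ae_eq_zero_of_integral_character_mul_eq_zero {k : Circle → ℂ}
    (hk : Integrable k haarCircle) (h : ∀ n : ℤ, ∫ x, character n x * k x ∂haarCircle = 0) :
    k =ᵐ[haarCircle] 0 := by
  have hcint : ∀ c : C(Circle, ℂ), Integrable (fun x => c x * k x) haarCircle := fun c =>
    hk.bdd_mul c.continuous.aestronglyMeasurable (Eventually.of_forall fun x => c.norm_coe_le_norm x)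
  let L : C(Circle, ℂ) →L[ℂ] ℂ := LinearMap.mkContinuous
    { toFun := fun c => ∫ x, c x * k x ∂haarCircle
      map_add' := fun c d => by
        simp only [ContinuousMap.add_apply, add_mul]
        exact integral_add (hcint c) (hcint d)
      map_smul' := fun a c => by
        simp only [ContinuousMap.smul_apply, smul_eq_mul, mul_assoc, RingHom.id_apply]
        exact integral_const_mul _ _ } (∫ x, ‖k x‖ ∂haarCircle) fun c => by
    rw [mul_comm, ← integral_const_mul]
    refine norm_integral_le_of_norm_le (hk.norm.const_mul _) (Eventually.of_forall fun x => ?_)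
    rw [norm_mul]
    gcongr
    exact c.norm_coe_le_norm x
  have hL : ∀ c : C(Circle, ℂ), ∫ x, c x * k x ∂haarCircle = 0 := fun c => by
    have hle : (Submodule.span ℂ (Set.range character)).topologicalClosure ≤ L.ker := by
      refine Submodule.topologicalClosure_minimal _ (Submodule.span_le.2 ?_) L.isClosed_ker
      rintro - ⟨n, rfl⟩
      exact h n
    rw [span_character_closure_eq_top] at hle
    exact hle (Submodule.mem_top (x := c))
  -- Indicators of closed sets are bounded pointwise limits of continuous functions, so the
  -- vanishing passes from `C(Circle, ℂ)` to integrals over closed sets.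
  refine ae_eq_zero_of_forall_setIntegral_isClosed_eq_zero hk fun F hF => ?_
  have hlim : Tendsto (fun n : ℕ => ∫ x, ((hF.apprSeq n x : ℝ) : ℂ) * k x ∂haarCircle) atTop
      (𝓝 (∫ x, F.indicator k x ∂haarCircle)) := by
    refine tendsto_integral_of_dominated_convergence (fun x => ‖k x‖) (fun n => ?_) hk.norm
      (fun n => Eventually.of_forall fun x => ?_) (Eventually.of_forall fun x => ?_)
    · refine AEStronglyMeasurable.mul ?_ hk.1
      exact (Complex.continuous_ofReal.comp
        (NNReal.continuous_coe.comp (hF.apprSeq n).continuous)).aestronglyMeasurable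
    · rw [norm_mul]
      refine mul_le_of_le_one_left (norm_nonneg _) ?_
      simpa using HasOuterApproxClosed.apprSeq_apply_le_one hF n x
    · have h1 := tendsto_pi_nhds.1 (HasOuterApproxClosed.tendsto_apprSeq hF) x
      have h2 : Tendsto (fun n => ((hF.apprSeq n x : ℝ) : ℂ) * k x) atTop
          (𝓝 ((((F.indicator (fun _ => (1 : NNReal)) x : NNReal) : ℝ) : ℂ) * k x)) :=
        ((Complex.continuous_ofReal.comp NNReal.continuous_coe).tendsto _ |>.comp h1).mul_const _
      by_cases hx : x ∈ F <;> simpa [hx] using h2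
  rw [← integral_indicator hF.measurableSet]
  refine tendsto_nhds_unique hlim ?_
  refine Tendsto.congr (fun n => ?_) tendsto_const_nhds
  exact (hL ⟨fun x => ((hF.apprSeq n x : ℝ) : ℂ), Complex.continuous_ofReal.comp
        (NNReal.continuous_coe.comp (hF.apprSeq n).continuous)⟩).symm

end Characters

/-! ### Bounded multipliers -/

section BoundedMultiplier

variable {ν : Measure Circle} {p q : ℝ≥0∞} [Fact (1 ≤ p)] [Fact (1 ≤ q)]

/-- The multiplication operator by a bounded function, given as a function. -/
def bmul {w : Circle → ℂ} (hw : MemLp w ∞ ν) : Lp ℂ p ν →L[ℂ] Lp ℂ p ν := mulOp (hw.toLp w)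

lemma coeFn_bmul {w : Circle → ℂ} (hw : MemLp w ∞ ν) (f : Lp ℂ p ν) :
    bmul hw f =ᵐ[ν] fun x => w x * f x := by
  filter_upwards [coeFn_mulOp (r := p) (hw.toLp w) f, hw.coeFn_toLp] with x h1 h2
  rw [bmul, h1, h2]

lemma incl_bmul [IsProbabilityMeasure ν] (h : p ≤ q) {w : Circle → ℂ} (hw : MemLp w ∞ ν)
    (f : Lp ℂ q ν) : (incl h (bmul hw f) : Lp ℂ p ν) = bmul hw (incl h f) := by
  refine Lp.ext ?_
  filter_upwards [coeFn_incl h (bmul hw f), coeFn_bmul hw f, coeFn_incl h f,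
    coeFn_bmul hw (incl h f : Lp ℂ p ν)] with x h1 h2 h3 h4
  rw [h1, h2, h4, h3]

lemma mem_mulSubspace_iff {w : Circle → ℂ} (hw : MemLp w ∞ ν) {S : Submodule ℂ (Lp ℂ p ν)}
    {f : Lp ℂ p ν} :
    f ∈ mulSubspace w Measure.AbsolutelyContinuous.rfl S ↔ ∃ h ∈ S, bmul hw h = f := by
  constructor
  · rintro ⟨h, hS, e⟩
    exact ⟨h, hS, Lp.ext ((coeFn_bmul hw h).trans e.symm)⟩
  · rintro ⟨h, hS, rfl⟩
    exact ⟨h, hS, coeFn_bmul hw h⟩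

end BoundedMultiplier

/-! ### Invariant subspaces and $H^p$ -/

section Invariant

variable {ν : Measure Circle} [IsFiniteMeasure ν] {p q r s : ℝ≥0∞}
  [Fact (1 ≤ p)] [Fact (1 ≤ q)] [Fact (1 ≤ r)] [Fact (1 ≤ s)]

/-- Multiplication by `z ^ n` on `L^p(ν)`. -/
def zmul (n : ℤ) : Lp ℂ p ν →L[ℂ] Lp ℂ p ν :=
  mulOp (ContinuousMap.toLp ∞ ν ℂ (character n))

lemma coeFn_zmul (n : ℤ) (f : Lp ℂ p ν) : zmul n f =ᵐ[ν] fun x => character n x * f x := by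
  filter_upwards [coeFn_mulOp (r := p) (ContinuousMap.toLp ∞ ν ℂ (character n)) f,
    ContinuousMap.coeFn_toLp (p := ∞) (𝕜 := ℂ) ν (character n)] with x h1 h2
  rw [zmul, h1, h2]

lemma zmul_zmul (m n : ℤ) (f : Lp ℂ p ν) : zmul m (zmul n f) = zmul (m + n) f := by
  refine Lp.ext ?_
  filter_upwards [coeFn_zmul m (zmul n f), coeFn_zmul n f, coeFn_zmul (m + n) f] with x h1 h2 h3
  rw [h1, h2, h3, character_add, mul_assoc]

lemma zmul_zero (f : Lp ℂ p ν) : zmul 0 f = f := by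
  refine Lp.ext ?_
  filter_upwards [coeFn_zmul 0 f] with x h1
  rw [h1]
  simp

lemma mulOp_zmul [ENNReal.HolderTriple s q r] (w : Lp ℂ s ν) (n : ℤ) (f : Lp ℂ q ν) :
    (mulOp w (zmul n f) : Lp ℂ r ν) = zmul n (mulOp w f) := by
  refine Lp.ext ?_
  filter_upwards [coeFn_mulOp (r := r) w (zmul n f), coeFn_zmul n f, coeFn_mulOp (r := r) w f,
    coeFn_zmul n (mulOp w f : Lp ℂ r ν)] with x h1 h2 h3 h4
  rw [h1, h2, h4, h3, mul_left_comm]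

/-- Closed subspaces of `L^p` that are invariant under multiplication by `z`. -/
structure IsInvariant (S : Submodule ℂ (Lp ℂ p ν)) : Prop where
  isClosed : IsClosed (S : Set (Lp ℂ p ν))
  zmul_mem : ∀ f ∈ S, zmul 1 f ∈ S

lemma IsInvariant.zmul_natCast_mem {S : Submodule ℂ (Lp ℂ p ν)} (hS : IsInvariant S) (n : ℕ)
    {f : Lp ℂ p ν} (hf : f ∈ S) : zmul n f ∈ S := by
  induction n with
  | zero => simpa [zmul_zero] using hf
  | succ n ih =>
    have h := hS.zmul_mem _ ih
    rwa [zmul_zmul, add_comm] at h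

/-- The main device below: to show that an operator commuting with $z$ maps a generated subspace
into `S`, check the generator against this preimage. -/
lemma IsInvariant.comap {S : Submodule ℂ (Lp ℂ p ν)} (hS : IsInvariant S)
    (T : Lp ℂ q ν →L[ℂ] Lp ℂ p ν) (hT : ∀ f, T (zmul 1 f) = zmul 1 (T f)) :
    IsInvariant (S.comap T.toLinearMap) where
  isClosed := hS.isClosed.preimage T.continuous
  zmul_mem f hf := by
    have h := hS.zmul_mem _ hf
    rw [ContinuousLinearMap.coe_coe, ← hT] at h
    exact h

lemma isInvariant_topologicalClosure {S : Submodule ℂ (Lp ℂ p ν)}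
    (hS : ∀ f ∈ S, zmul 1 f ∈ S) : IsInvariant S.topologicalClosure where
  isClosed := S.isClosed_topologicalClosure
  zmul_mem f hf := by
    have hle : S.topologicalClosure ≤
        S.topologicalClosure.comap (zmul 1 : Lp ℂ p ν →L[ℂ] Lp ℂ p ν).toLinearMap :=
      Submodule.topologicalClosure_minimal _ (fun g hg => S.le_topologicalClosure (hS g hg))
        (S.isClosed_topologicalClosure.preimage (zmul 1 : Lp ℂ p ν →L[ℂ] Lp ℂ p ν).continuous)
    exact hle hf

/-- The constant function one in `L^p`. -/
def one (p : ℝ≥0∞) [Fact (1 ≤ p)] (ν : Measure Circle) [IsFiniteMeasure ν] : Lp ℂ p ν :=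
  ContinuousMap.toLp p ν ℂ 1

lemma coeFn_one (p : ℝ≥0∞) [Fact (1 ≤ p)] (ν : Measure Circle) [IsFiniteMeasure ν] :
    one p ν =ᵐ[ν] fun _ => 1 :=
  ContinuousMap.coeFn_toLp ν 1

lemma toLp_character (n : ℤ) : ContinuousMap.toLp p ν ℂ (character n) = zmul n (one p ν) := by
  refine Lp.ext ?_
  filter_upwards [ContinuousMap.coeFn_toLp (p := p) (𝕜 := ℂ) ν (character n), coeFn_one p ν,
    coeFn_zmul n (one p ν)] with x h1 h2 h3
  rw [h1, h3, h2, mul_one]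

lemma toLp_coordinate_pow (n : ℕ) :
    ContinuousMap.toLp p ν ℂ (coordinate ^ n) = zmul n (one p ν) := by
  rw [← toLp_character, show coordinate ^ n = character n from
    ContinuousMap.ext (coordinate_pow_apply n)]

lemma isInvariant_hardySpace : IsInvariant (hardySpace p ν) := by
  refine isInvariant_topologicalClosure fun f hf => ?_
  induction hf using Submodule.span_induction with
  | mem f hf =>
    obtain ⟨n, rfl⟩ := hf
    refine Submodule.subset_span ⟨n + 1, ?_⟩
    simp only [toLp_coordinate_pow, zmul_zmul]
    rw [add_comm]
    norm_cast
  | zero => simp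
  | add f g _ _ hf hg => rw [map_add]; exact Submodule.add_mem _ hf hg
  | smul a f _ hf => rw [map_smul]; exact Submodule.smul_mem _ a hf

lemma one_mem_hardySpace : one p ν ∈ hardySpace p ν := by
  refine Submodule.le_topologicalClosure _ (Submodule.subset_span ⟨0, ?_⟩)
  simp [one]

/-- `H^p` is the least invariant subspace containing the constants. -/
lemma IsInvariant.hardySpace_le {S : Submodule ℂ (Lp ℂ p ν)} (hS : IsInvariant S)
    (h1 : one p ν ∈ S) : hardySpace p ν ≤ S := by
  refine Submodule.topologicalClosure_minimal _ (Submodule.span_le.2 ?_) hS.isClosed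
  rintro - ⟨n, rfl⟩
  simp only [toLp_coordinate_pow]
  exact hS.zmul_natCast_mem n h1

lemma incl_zmul [IsProbabilityMeasure ν] (h : p ≤ q) (n : ℤ) (f : Lp ℂ q ν) :
    (incl h (zmul n f) : Lp ℂ p ν) = zmul n (incl h f) := by
  refine Lp.ext ?_
  filter_upwards [coeFn_incl h (zmul n f), coeFn_zmul n f, coeFn_incl h f,
    coeFn_zmul n (incl h f : Lp ℂ p ν)] with x h1 h2 h3 h4
  rw [h1, h2, h4, h3]

lemma incl_one [IsProbabilityMeasure ν] (h : p ≤ q) : (incl h (one q ν) : Lp ℂ p ν) = one p ν := by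
  refine Lp.ext ?_
  filter_upwards [coeFn_incl h (one q ν), coeFn_one p ν, coeFn_one q ν] with x h1 h2 h3
  rw [h1, h2, h3]

lemma bmul_zmul {w : Circle → ℂ} (hw : MemLp w ∞ ν) (n : ℤ) (f : Lp ℂ p ν) :
    bmul hw (zmul n f) = zmul n (bmul hw f) := mulOp_zmul _ n f

lemma mulSubspace_coe_le_iff {S : Submodule ℂ (Lp ℂ p ν)} :
    mulSubspace (fun z : Circle => (z : ℂ)) Measure.AbsolutelyContinuous.rfl S ≤ S ↔
      ∀ f ∈ S, zmul 1 f ∈ S := by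
  constructor
  · intro h f hf
    refine h ⟨f, hf, ?_⟩
    simpa using coeFn_zmul 1 f
  · rintro h f ⟨g, hg, e⟩
    have : f = zmul 1 g := Lp.ext (e.trans (by simpa using (coeFn_zmul 1 g).symm))
    rw [this]
    exact h g hg

end Invariant

/-! ### The subspaces $\varphi H^p$ and $\chi_E L^p$ -/

section Unimodular

variable {p : ℝ≥0∞} [Fact (1 ≤ p)]

lemma IsUnimodular.memLp {φ : Circle → ℂ} (hφ : IsUnimodular φ) : MemLp φ ∞ haarCircle :=
  memLp_top_of_bound hφ.1.aestronglyMeasurable 1 (hφ.2.mono fun _ h => h.le)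

lemma IsUnimodular.conj {φ : Circle → ℂ} (hφ : IsUnimodular φ) :
    IsUnimodular fun x => (starRingEnd ℂ) (φ x) :=
  ⟨RCLike.continuous_conj.measurable.comp hφ.1, hφ.2.mono fun x h => by rwa [RCLike.norm_conj]⟩

lemma bmul_conj_bmul {φ : Circle → ℂ} (hφ : IsUnimodular φ) (f : Lp ℂ p haarCircle) :
    bmul hφ.conj.memLp (bmul hφ.memLp f) = f := by
  refine Lp.ext ?_
  filter_upwards [coeFn_bmul hφ.conj.memLp (bmul hφ.memLp f), coeFn_bmul hφ.memLp f, hφ.2]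
    with x h1 h2 h3
  rw [h1, h2, ← mul_assoc, Complex.conj_mul', h3]
  simp

lemma bmul_bmul_conj {φ : Circle → ℂ} (hφ : IsUnimodular φ) (f : Lp ℂ p haarCircle) :
    bmul hφ.memLp (bmul hφ.conj.memLp f) = f := by
  refine Lp.ext ?_
  filter_upwards [coeFn_bmul hφ.memLp (bmul hφ.conj.memLp f), coeFn_bmul hφ.conj.memLp f, hφ.2]
    with x h1 h2 h3
  rw [h1, h2, ← mul_assoc, Complex.mul_conj', h3]
  simp

/-- `φ S` consists of the functions `f` with `conj φ * f` in `S`. -/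
lemma mulSubspace_unimodular_eq_comap {φ : Circle → ℂ} (hφ : IsUnimodular φ)
    (S : Submodule ℂ (Lp ℂ p haarCircle)) :
    mulSubspace φ Measure.AbsolutelyContinuous.rfl S =
      S.comap (bmul hφ.conj.memLp : Lp ℂ p haarCircle →L[ℂ] Lp ℂ p haarCircle).toLinearMap := by
  ext f
  rw [mem_mulSubspace_iff hφ.memLp, Submodule.mem_comap, ContinuousLinearMap.coe_coe]
  constructor
  · rintro ⟨h, hS, rfl⟩
    rwa [bmul_conj_bmul hφ]
  · intro h
    exact ⟨_, h, bmul_bmul_conj hφ f⟩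

lemma memLp_indicator {E : Set Circle} (hE : MeasurableSet E) :
    MemLp (E.indicator fun _ => (1 : ℂ)) ∞ haarCircle :=
  (memLp_const 1).indicator hE

lemma mem_mulSubspace_indicator_iff {E : Set Circle} (hE : MeasurableSet E)
    {f : Lp ℂ p haarCircle} :
    f ∈ mulSubspace (E.indicator fun _ => (1 : ℂ)) Measure.AbsolutelyContinuous.rfl
      (⊤ : Submodule ℂ (Lp ℂ p haarCircle)) ↔ bmul (memLp_indicator hE) f = f := by
  rw [mem_mulSubspace_iff (memLp_indicator hE)]
  constructor
  · rintro ⟨h, -, rfl⟩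
    refine Lp.ext ?_
    filter_upwards [coeFn_bmul (memLp_indicator hE) (bmul (memLp_indicator hE) h),
      coeFn_bmul (memLp_indicator hE) h] with x h1 h2
    rw [h1, h2]
    by_cases hx : x ∈ E <;> simp [hx]
  · intro h
    exact ⟨f, trivial, h⟩

lemma isInvariant_mulSubspace_indicator {E : Set Circle} (hE : MeasurableSet E) :
    IsInvariant (mulSubspace (E.indicator fun _ => (1 : ℂ)) Measure.AbsolutelyContinuous.rfl
      (⊤ : Submodule ℂ (Lp ℂ p haarCircle))) where
  isClosed := by
    have h : IsClosed {f : Lp ℂ p haarCircle | bmul (memLp_indicator hE) f = f} :=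
      isClosed_eq (bmul (memLp_indicator hE)).continuous continuous_id
    convert h using 1
    ext f
    exact mem_mulSubspace_indicator_iff hE
  zmul_mem f hf := by
    rw [mem_mulSubspace_indicator_iff hE] at hf ⊢
    rw [bmul_zmul, hf]

lemma isInvariant_mulSubspace_unimodular {φ : Circle → ℂ} (hφ : IsUnimodular φ) :
    IsInvariant (mulSubspace φ Measure.AbsolutelyContinuous.rfl (hardySpace p haarCircle)) := by
  rw [mulSubspace_unimodular_eq_comap hφ]
  exact isInvariant_hardySpace.comap _ (bmul_zmul _ 1)

end Unimodular

/-! ### The Beurling–Helson theorem in $L^2$ -/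

section HilbertSpace

lemma integrable_mul_conj (f g : Lp ℂ 2 haarCircle) :
    Integrable (fun x => f x * (starRingEnd ℂ) (g x)) haarCircle := by
  have h := L2.integrable_inner (𝕜 := ℂ) g f
  simpa [RCLike.inner_apply] using h

lemma inner_zmul_eq_integral (n : ℤ) (f g : Lp ℂ 2 haarCircle) :
    inner ℂ g (zmul n f) =
      ∫ x, character n x * (f x * (starRingEnd ℂ) (g x)) ∂haarCircle := by
  rw [L2.inner_def]
  refine integral_congr_ae ?_
  filter_upwards [coeFn_zmul n f] with x hx
  rw [hx, RCLike.inner_apply, mul_assoc]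

lemma inner_zmul_neg (n : ℤ) (f g : Lp ℂ 2 haarCircle) :
    inner ℂ g (zmul (-n) f) = inner ℂ (zmul n g) f := by
  rw [L2.inner_def, L2.inner_def]
  refine integral_congr_ae ?_
  filter_upwards [coeFn_zmul (-n) f, coeFn_zmul n g] with x h1 h2
  rw [h1, h2, RCLike.inner_apply, RCLike.inner_apply, map_mul, conj_character]
  ring

/-- These inner products are all the Fourier coefficients of the integrable function $f\bar g$, so
orthogonality to every shift is pointwise. -/
lemma mul_conj_ae_eq_zero {f g : Lp ℂ 2 haarCircle} (h : ∀ n : ℤ, inner ℂ g (zmul n f) = 0) :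
    ∀ᵐ x ∂haarCircle, f x * (starRingEnd ℂ) (g x) = 0 :=
  ae_eq_zero_of_integral_character_mul_eq_zero (integrable_mul_conj f g) fun n => by
    rw [← inner_zmul_eq_integral, h]

/-- A unit vector orthogonal to its forward shifts has modulus one. -/
lemma isUnimodular_of_inner_zmul {F : Lp ℂ 2 haarCircle} (hF : ‖F‖ = 1)
    (h : ∀ n : ℕ, inner ℂ F (zmul ((n : ℤ) + 1) F) = 0) : IsUnimodular F := by
  refine ⟨(Lp.stronglyMeasurable F).measurable, ?_⟩
  have hne : ∀ n : ℤ, n ≠ 0 → inner ℂ F (zmul n F) = 0 := fun n hn => by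
    rcases lt_or_gt_of_ne hn with hneg | hpos
    · obtain ⟨k, hk⟩ := Int.eq_ofNat_of_zero_le (by omega : 0 ≤ -n - 1)
      have h1 := h k
      rw [show (k : ℤ) + 1 = -n by omega, inner_zmul_neg] at h1
      exact inner_eq_zero_symm.1 h1
    · obtain ⟨k, hk⟩ := Int.eq_ofNat_of_zero_le (by omega : 0 ≤ n - 1)
      rw [show n = (k : ℤ) + 1 by omega]
      exact h k
  have hint := integrable_mul_conj F F
  -- The function $|F|^2-1$ has zero Fourier coefficients: for $n\ne 0$ by orthogonality, for $n=0$
  -- by $\|F\|=1$.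
  have hzero := ae_eq_zero_of_integral_character_mul_eq_zero
    (k := fun x => F x * (starRingEnd ℂ) (F x) - 1) (hint.sub (integrable_const 1)) fun n => by
      have hi1 : Integrable (fun x => character n x * (F x * (starRingEnd ℂ) (F x))) haarCircle :=
        hint.bdd_mul (character n).continuous.aestronglyMeasurable
          (Eventually.of_forall fun x => (norm_character n x).le)
      have hi2 : Integrable (fun x => character n x) haarCircle :=
        (character n).continuous.integrable_of_hasCompactSupport
          (HasCompactSupport.of_compactSpace _)
      simp only [mul_sub, mul_one]
      rw [integral_sub hi1 hi2, ← inner_zmul_eq_integral]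
      rcases eq_or_ne n 0 with rfl | hn
      · rw [zmul_zero, inner_self_eq_norm_sq_to_K, hF]
        simp
      · rw [hne n hn, integral_character_of_ne hn, sub_zero]
  filter_upwards [hzero] with x hx
  have h1 : F x * (starRingEnd ℂ) (F x) = 1 := by
    simpa [sub_eq_zero] using hx
  rw [Complex.mul_conj'] at h1
  have h2 : ‖F x‖ ^ 2 = 1 := by exact_mod_cast h1
  nlinarith [norm_nonneg (F x)]

/-- Doubly invariant subspaces of `L²` are of the form `χ_E L²`. -/
lemma exists_eq_indicator_of_doubly_invariant {N : Submodule ℂ (Lp ℂ 2 haarCircle)}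
    (hN : IsClosed (N : Set (Lp ℂ 2 haarCircle))) (hz : ∀ n : ℤ, ∀ f ∈ N, zmul n f ∈ N) :
    ∃ E : Set Circle, MeasurableSet E ∧
      N = mulSubspace (E.indicator fun _ => (1 : ℂ)) Measure.AbsolutelyContinuous.rfl
        (⊤ : Submodule ℂ (Lp ℂ 2 haarCircle)) := by
  have : CompleteSpace N := hN.completeSpace_coe
  set e : Lp ℂ 2 haarCircle := N.starProjection (one 2 haarCircle) with he
  have heN : e ∈ N := Submodule.starProjection_apply_mem _ _
  set d : Lp ℂ 2 haarCircle := one 2 haarCircle - e with hd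
  have hdN : d ∈ Nᗮ := Submodule.sub_starProjection_mem_orthogonal _
  have hdx : ∀ᵐ x ∂haarCircle, d x = 1 - e x := by
    filter_upwards [Lp.coeFn_sub (one 2 haarCircle) e, coeFn_one 2 haarCircle] with x h1 h2
    rw [hd, h1, Pi.sub_apply, h2]
  -- All shifts of $f$ stay in $N$ while $1-e\perp N$. Taking $f=e$ shows that $e$ has only the
  -- values $0$ and $1$.
  have hfd : ∀ f ∈ N, ∀ᵐ x ∂haarCircle, f x * (starRingEnd ℂ) (1 - e x) = 0 := fun f hf => by
    have h := mul_conj_ae_eq_zero (f := f) (g := d) fun n =>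
      Submodule.inner_left_of_mem_orthogonal (hz n f hf) hdN
    filter_upwards [h, hdx] with x h1 h2
    rwa [h2] at h1
  set E : Set Circle := {x | e x = 1} with hE
  have hEm : MeasurableSet E := (Lp.stronglyMeasurable e).measurable (measurableSet_singleton 1)
  have heE : ∀ᵐ x ∂haarCircle, e x = E.indicator (fun _ => (1 : ℂ)) x := by
    filter_upwards [hfd e heN] with x hx
    by_cases h1 : e x = 1
    · rw [Set.indicator_of_mem (show x ∈ E from h1), h1]
    · rw [Set.indicator_of_notMem (show x ∉ E from h1)]
      refine (mul_eq_zero.1 hx).resolve_right fun h0 => h1 ?_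
      rw [map_eq_zero, sub_eq_zero] at h0
      exact h0.symm
  refine ⟨E, hEm, le_antisymm (fun f hf => ?_) (fun f hf => ?_)⟩
  · rw [mem_mulSubspace_indicator_iff hEm]
    refine Lp.ext ?_
    filter_upwards [coeFn_bmul (memLp_indicator hEm) f, hfd f hf] with x h1 h2
    rw [h1]
    by_cases hx : x ∈ E
    · rw [Set.indicator_of_mem hx, one_mul]
    · rw [Set.indicator_of_notMem hx, zero_mul]
      refine ((mul_eq_zero.1 h2).resolve_right fun h0 => hx ?_).symm
      rw [map_eq_zero, sub_eq_zero] at h0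
      exact h0.symm
  · rw [mem_mulSubspace_indicator_iff hEm] at hf
    rw [← Submodule.orthogonal_orthogonal N]
    refine (Submodule.mem_orthogonal _ _).2 fun g hg => ?_
    -- Any $g\perp N$ satisfies $e\bar g=0$, so it vanishes on $E$ and is orthogonal to every $f$
    -- supported there.
    have hge := mul_conj_ae_eq_zero (f := e) (g := g) fun n =>
      Submodule.inner_left_of_mem_orthogonal (hz n e heN) hg
    rw [L2.inner_def]
    refine integral_eq_zero_of_ae ?_
    have hfx := coeFn_bmul (memLp_indicator hEm) f
    rw [hf] at hfx
    filter_upwards [hge, heE, hfx] with x h1 h2 h3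
    rw [RCLike.inner_apply, h3, ← h2]
    calc e x * f x * (starRingEnd ℂ) (g x) = f x * (e x * (starRingEnd ℂ) (g x)) := by ring
      _ = 0 := by rw [h1, mul_zero]

/-- Invariant subspaces of `L²` that are not doubly invariant are of the form `φ H²`. -/
lemma exists_eq_unimodular_of_not_doubly_invariant {N : Submodule ℂ (Lp ℂ 2 haarCircle)}
    (hN : IsInvariant N) {f : Lp ℂ 2 haarCircle} (hf : f ∈ N) (hfz : zmul (-1) f ∉ N) :
    ∃ φ : Circle → ℂ, IsUnimodular φ ∧
      N = mulSubspace φ Measure.AbsolutelyContinuous.rfl (hardySpace 2 haarCircle) := by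
  -- $Z=zN$, a closed proper subspace of $N$; the generator is the normalized component of $f$
  -- orthogonal to it.
  set Z : Submodule ℂ (Lp ℂ 2 haarCircle) :=
    N.comap (zmul (-1) : Lp ℂ 2 haarCircle →L[ℂ] Lp ℂ 2 haarCircle).toLinearMap with hZ
  have hmemZ : ∀ g, g ∈ Z ↔ zmul (-1) g ∈ N := fun g => by
    rw [hZ, Submodule.mem_comap, ContinuousLinearMap.coe_coe]
  have hZinv : IsInvariant Z := hN.comap _ fun g => by rw [zmul_zmul, zmul_zmul]; rfl
  have hZN : Z ≤ N := fun g hg => by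
    have h := hN.zmul_mem _ ((hmemZ g).1 hg)
    rwa [zmul_zmul, show (1 : ℤ) + -1 = 0 from rfl, zmul_zero] at h
  have hshift : ∀ g ∈ N, ∀ n : ℕ, zmul ((n : ℤ) + 1) g ∈ Z := fun g hg n => by
    rw [hmemZ, zmul_zmul, show (-1 : ℤ) + (n + 1) = n by ring]
    exact hN.zmul_natCast_mem n hg
  have : CompleteSpace Z := hZinv.isClosed.completeSpace_coe
  set G := f - Z.starProjection f with hG
  have hGZ : G ∈ Zᗮ := Submodule.sub_starProjection_mem_orthogonal _
  have hGN : G ∈ N := N.sub_mem hf (hZN (Submodule.starProjection_apply_mem _ _))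
  have hG0 : G ≠ 0 := fun h0 => hfz ((hmemZ f).1 (by
    rw [sub_eq_zero.1 h0]; exact Submodule.starProjection_apply_mem _ _))
  set F : Lp ℂ 2 haarCircle := ((‖G‖⁻¹ : ℝ) : ℂ) • G with hF
  have hFN : F ∈ N := N.smul_mem _ hGN
  have hFZ : F ∈ Zᗮ := Submodule.smul_mem _ _ hGZ
  have hF1 : ‖F‖ = 1 := by
    rw [hF, norm_smul, Complex.norm_real, norm_inv, norm_norm, inv_mul_cancel₀ (norm_ne_zero_iff.2 hG0)]
  have hφ : IsUnimodular F := isUnimodular_of_inner_zmul hF1 fun n =>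
    Submodule.inner_left_of_mem_orthogonal (hshift F hFN n) hFZ
  have hφ1 : bmul hφ.memLp (one 2 haarCircle) = F := by
    refine Lp.ext ?_
    filter_upwards [coeFn_bmul hφ.memLp (one 2 haarCircle), coeFn_one 2 haarCircle] with x h1 h2
    rw [h1, h2, mul_one]
  set K := mulSubspace F Measure.AbsolutelyContinuous.rfl (hardySpace 2 haarCircle) with hK
  have hKinv : IsInvariant K := isInvariant_mulSubspace_unimodular hφ
  have hFK : F ∈ K := (mem_mulSubspace_iff hφ.memLp).2 ⟨_, one_mem_hardySpace, hφ1⟩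
  have hKN : K ≤ N := fun g hg => by
    obtain ⟨w, hw, rfl⟩ := (mem_mulSubspace_iff hφ.memLp).1 hg
    have hle : hardySpace 2 haarCircle ≤ N.comap
        (bmul hφ.memLp : Lp ℂ 2 haarCircle →L[ℂ] Lp ℂ 2 haarCircle).toLinearMap :=
      (hN.comap _ (bmul_zmul _ 1)).hardySpace_le (by
        rw [Submodule.mem_comap, ContinuousLinearMap.coe_coe, hφ1]
        exact hFN)
    exact hle hw
  refine ⟨F, hφ, le_antisymm (fun g hg => ?_) hKN⟩
  have : CompleteSpace K := hKinv.isClosed.completeSpace_coe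
  set w := g - K.starProjection g with hw
  have hwK : w ∈ Kᗮ := Submodule.sub_starProjection_mem_orthogonal _
  have hPK : K.starProjection g ∈ K := Submodule.starProjection_apply_mem _ _
  have hwN : w ∈ N := N.sub_mem hg (hKN hPK)
  -- For $n\le 0$ the shift moves onto $F$, and $z^{-n}F\in K\perp w$. For $n>0$, $z^n w\in zN\perp
  -- F$. Hence $w\bar F=0$, and $|F|=1$ forces $w=0$.
  have hw0 := mul_conj_ae_eq_zero (f := w) (g := F) fun n => by
    rcases le_or_gt n 0 with hn | hn
    · obtain ⟨k, hk⟩ := Int.eq_ofNat_of_zero_le (by omega : 0 ≤ -n)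
      rw [show n = -(k : ℤ) by omega, inner_zmul_neg]
      exact Submodule.inner_right_of_mem_orthogonal (hKinv.zmul_natCast_mem k hFK) hwK
    · obtain ⟨k, hk⟩ := Int.eq_ofNat_of_zero_le (by omega : 0 ≤ n - 1)
      rw [show n = (k : ℤ) + 1 by omega]
      exact Submodule.inner_left_of_mem_orthogonal (hshift w hwN k) hFZ
  have hwz : w = 0 := by
    refine Lp.ext ?_
    filter_upwards [hw0, hφ.2, Lp.coeFn_zero ℂ 2 haarCircle] with x h1 h2 h3
    rw [h3, Pi.zero_apply]
    refine (mul_eq_zero.1 h1).resolve_right fun h0 => ?_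
    rw [map_eq_zero] at h0
    rw [h0, norm_zero] at h2
    exact zero_ne_one h2
  rw [sub_eq_zero.1 hwz]
  exact hPK

/-- The **Beurling–Helson theorem** in `L²`. -/
theorem beurling_helson_two {N : Submodule ℂ (Lp ℂ 2 haarCircle)} (hN : IsInvariant N) :
    (∃ φ : Circle → ℂ, IsUnimodular φ ∧
      N = mulSubspace φ Measure.AbsolutelyContinuous.rfl (hardySpace 2 haarCircle)) ∨
    ∃ E : Set Circle, MeasurableSet E ∧
      N = mulSubspace (E.indicator fun _ => (1 : ℂ)) Measure.AbsolutelyContinuous.rfl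
        (⊤ : Submodule ℂ (Lp ℂ 2 haarCircle)) := by
  by_cases h : ∀ f ∈ N, zmul (-1) f ∈ N
  · have hneg : ∀ n : ℕ, ∀ f ∈ N, zmul (-(n : ℤ)) f ∈ N := fun n => by
      induction n with
      | zero => intro f hf; simpa [zmul_zero] using hf
      | succ n ih =>
        intro f hf
        have h1 := h _ (ih f hf)
        rwa [zmul_zmul, show (-1 : ℤ) + -(n : ℤ) = -((n + 1 : ℕ) : ℤ) by push_cast; ring] at h1
    refine Or.inr (exists_eq_indicator_of_doubly_invariant hN.isClosed fun n f hf => ?_)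
    rcases Int.eq_nat_or_neg n with ⟨k, rfl | rfl⟩
    · exact hN.zmul_natCast_mem k hf
    · exact hneg k f hf
  · push Not at h
    obtain ⟨f, hf, hfz⟩ := h
    exact Or.inl (exists_eq_unimodular_of_not_doubly_invariant hN hf hfz)

end HilbertSpace

/-! ### Outer functions and $L^2$ generators -/

section Outer

lemma isInvariant_sInf {p : ℝ≥0∞} [Fact (1 ≤ p)] {A : Set (Submodule ℂ (Lp ℂ p haarCircle))}
    (hA : ∀ S ∈ A, IsInvariant S) : IsInvariant (sInf A) where
  isClosed := by
    rw [Submodule.coe_sInf]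
    exact isClosed_biInter fun S hS => (hA S hS).isClosed
  zmul_mem f hf := by
    rw [Submodule.mem_sInf] at hf ⊢
    exact fun S hS => (hA S hS).zmul_mem f (hf S hS)

/-- Pairing with $z^{-1}$ kills $z^n$ for every $n\ge 0$, hence $H^2$, but not $z^{-1}$ itself. -/
lemma zmul_neg_one_one_notMem_hardySpace :
    zmul (-1) (one 2 haarCircle) ∉ hardySpace 2 haarCircle := by
  intro hmem
  set g := zmul (-1) (one 2 haarCircle) with hg
  have hinner : ∀ n : ℤ, inner ℂ g (zmul n (one 2 haarCircle)) =
      ∫ x, character (n + 1) x ∂haarCircle := fun n => by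
    rw [inner_zmul_eq_integral]
    refine integral_congr_ae ?_
    filter_upwards [coeFn_zmul (-1) (one 2 haarCircle), coeFn_one 2 haarCircle] with x h1 h2
    rw [hg, h1, h2, mul_one, one_mul, conj_character, character_add, neg_neg]
  have hle : hardySpace 2 haarCircle ≤ (innerSL ℂ g).ker := by
    refine Submodule.topologicalClosure_minimal _ (Submodule.span_le.2 ?_)
      (innerSL ℂ g).isClosed_ker
    rintro - ⟨n, rfl⟩
    simp only [toLp_coordinate_pow, SetLike.mem_coe, LinearMap.mem_ker]
    exact (hinner n).trans (integral_character_of_ne (by omega))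
  have h0 : inner ℂ g g = 0 := hle hmem
  have h1 := hinner (-1)
  rw [← hg, h0] at h1
  simp at h1

/-- Existence of outer functions: a function `s ≥ 1` in `L²` is the modulus of a cyclic vector of
`H²`. -/
theorem exists_outer {s : Circle → ℝ} (hs1 : ∀ x, 1 ≤ s x)
    (hs : MemLp (fun x => (s x : ℂ)) 2 haarCircle) :
    ∃ h : Lp ℂ 2 haarCircle, h ∈ hardySpace 2 haarCircle ∧ (∀ᵐ x ∂haarCircle, ‖h x‖ = s x) ∧
      ∀ S : Submodule ℂ (Lp ℂ 2 haarCircle), IsInvariant S → h ∈ S → one 2 haarCircle ∈ S := by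
  set σ : Lp ℂ 2 haarCircle := hs.toLp _ with hσ
  have hσx : ∀ᵐ x ∂haarCircle, σ x = (s x : ℂ) := hs.coeFn_toLp
  have hpos : ∀ x, 0 < s x := fun x => zero_lt_one.trans_le (hs1 x)
  set S₀ : Submodule ℂ (Lp ℂ 2 haarCircle) := sInf {S | IsInvariant S ∧ σ ∈ S} with hS₀
  have hS₀inv : IsInvariant S₀ := isInvariant_sInf fun S hS => hS.1
  have hσS₀ : σ ∈ S₀ := Submodule.mem_sInf.2 fun S hS => hS.2
  have hmin : ∀ S : Submodule ℂ (Lp ℂ 2 haarCircle), IsInvariant S → σ ∈ S → S₀ ≤ S :=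
    fun S h1 h2 => sInf_le ⟨h1, h2⟩
  rcases beurling_helson_two hS₀inv with ⟨φ, hφ, hS₀φ⟩ | ⟨E, hE, hS₀E⟩
  -- Here $\sigma=\varphi h$, so $|h|=s$. As $\sigma$ generates $\varphi H^2$, dividing by $\varphi$
  -- shows that $h$ generates $H^2$.
  · obtain ⟨h, hh, hφh⟩ := (mem_mulSubspace_iff hφ.memLp).1 (hS₀φ ▸ hσS₀)
    refine ⟨h, hh, ?_, fun S hS hhS => ?_⟩
    · have h1 := coeFn_bmul hφ.memLp h
      rw [hφh] at h1
      filter_upwards [h1, hσx, hφ.2] with x h1 h2 h3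
      have h4 : ‖(s x : ℂ)‖ = ‖φ x * h x‖ := by rw [← h2, h1]
      rw [norm_mul, h3, one_mul, Complex.norm_real, Real.norm_eq_abs, abs_of_pos (hpos x)] at h4
      exact h4.symm
    · have hle : S₀ ≤ S.comap
          (bmul hφ.conj.memLp : Lp ℂ 2 haarCircle →L[ℂ] Lp ℂ 2 haarCircle).toLinearMap :=
        hmin _ (hS.comap _ (bmul_zmul _ 1)) (by
          rw [Submodule.mem_comap, ContinuousLinearMap.coe_coe, ← hφh, bmul_conj_bmul hφ]
          exact hhS)
      have h1 : bmul hφ.memLp (one 2 haarCircle) ∈ S₀ := by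
        rw [hS₀φ]
        exact (mem_mulSubspace_iff hφ.memLp).2 ⟨_, one_mem_hardySpace, rfl⟩
      have h2 := hle h1
      rwa [Submodule.mem_comap, ContinuousLinearMap.coe_coe, bmul_conj_bmul hφ] at h2
  -- In this case $z^{-1}\sigma\in S_0$. Since $s\ge 1$, $1/s$ is a bounded multiplier sending
  -- $\sigma$ to $1$, hence $S_0$ into $H^2$, and this would put $z^{-1}$ in $H^2$.
  · exfalso
    have hbd : MemLp (fun x => (s x : ℂ)⁻¹) ∞ haarCircle := by
      refine memLp_top_of_bound hs.1.aemeasurable.inv.aestronglyMeasurable 1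
        (Eventually.of_forall fun x => ?_)
      rw [norm_inv, Complex.norm_real, Real.norm_eq_abs, abs_of_pos (hpos x)]
      exact inv_le_one_of_one_le₀ (hs1 x)
    have hT : bmul hbd σ = one 2 haarCircle := by
      refine Lp.ext ?_
      filter_upwards [coeFn_bmul hbd σ, hσx, coeFn_one 2 haarCircle] with x h1 h2 h3
      rw [h1, h2, h3, inv_mul_cancel₀ (by exact_mod_cast (hpos x).ne')]
    have hle : S₀ ≤ (hardySpace 2 haarCircle).comap
        (bmul hbd : Lp ℂ 2 haarCircle →L[ℂ] Lp ℂ 2 haarCircle).toLinearMap :=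
      hmin _ (isInvariant_hardySpace.comap _ (bmul_zmul _ 1)) (by
        rw [Submodule.mem_comap, ContinuousLinearMap.coe_coe, hT]
        exact one_mem_hardySpace)
    have h1 : zmul (-1) σ ∈ S₀ := by
      rw [hS₀E, mem_mulSubspace_indicator_iff hE] at hσS₀ ⊢
      rw [bmul_zmul, hσS₀]
    have h2 := hle h1
    rw [Submodule.mem_comap, ContinuousLinearMap.coe_coe, bmul_zmul, hT] at h2
    exact zmul_neg_one_one_notMem_hardySpace h2

/-- Every `k ∈ L^q`, `1 ≤ q ≤ 2`, generates the same invariant subspace of `L^q` as some function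
in `L²`. -/
theorem exists_L2_generator {q : ℝ≥0∞} [Fact (1 ≤ q)] (hq : q ≤ 2) (k : Lp ℂ q haarCircle) :
    ∃ u : Lp ℂ 2 haarCircle, ∀ S : Submodule ℂ (Lp ℂ q haarCircle), IsInvariant S →
      (k ∈ S ↔ incl hq u ∈ S) := by
  rcases eq_or_lt_of_le hq with rfl | hlt
  · refine ⟨k, fun S _ => ?_⟩
    rw [show incl hq k = k from Lp.ext (coeFn_incl hq k)]
  have hq1 : (1 : ℝ≥0∞) ≤ q := Fact.out
  have hqt : q ≠ ∞ := (hlt.trans_le le_top).ne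
  set t := q.toReal with ht
  have hqt' : q = ENNReal.ofReal t := (ENNReal.ofReal_toReal hqt).symm
  have ht1 : 1 ≤ t := by simpa using ENNReal.toReal_mono hqt hq1
  have ht2 : t < 2 := by simpa using ENNReal.toReal_strict_mono (by simp) hlt
  -- Determined by $1/\rho+1/2=1/t$; the bound $\rho\ge 2$ is equivalent to $t\ge 1$.
  set ρ := t / (1 - t / 2) with hρ
  have hc : 0 < 1 - t / 2 := by linarith
  have hρ2 : 2 ≤ ρ := by rw [hρ, le_div_iff₀ hc]; linarith
  set r := ENNReal.ofReal ρ with hr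
  have hr2 : 2 ≤ r := by
    rw [hr, show (2 : ℝ≥0∞) = ENNReal.ofReal 2 by simp]
    exact ENNReal.ofReal_le_ofReal hρ2
  have : Fact (1 ≤ r) := ⟨one_le_two.trans hr2⟩
  have : ENNReal.HolderTriple r 2 q := ⟨by
    rw [hr, hqt', show (2 : ℝ≥0∞) = ENNReal.ofReal 2 by simp,
      ← ENNReal.ofReal_inv_of_pos (by linarith), ← ENNReal.ofReal_inv_of_pos (by norm_num),
      ← ENNReal.ofReal_inv_of_pos (by linarith), ← ENNReal.ofReal_add (by positivity) (by norm_num)]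
    congr 1
    rw [hρ]
    field_simp
    ring⟩
  set b : Circle → ℝ := fun x => max 1 ‖k x‖ with hb
  have hb1 : ∀ x, 1 ≤ b x := fun x => le_max_left _ _
  have hb0 : ∀ x, 0 < b x := fun x => zero_lt_one.trans_le (hb1 x)
  have hbq : MemLp b q haarCircle := by
    refine ((memLp_const (1 : ℝ)).add (Lp.memLp k).norm).mono
      (aestronglyMeasurable_const.sup (Lp.memLp k).1.norm) (Eventually.of_forall fun x => ?_)
    rw [Real.norm_eq_abs, Real.norm_eq_abs, abs_of_pos (hb0 x)]
    refine le_trans (max_le ?_ ?_) (le_abs_self _)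
    · simp
    · simp
  have hs : MemLp (fun x => ((b x ^ (t / 2) : ℝ) : ℂ)) 2 haarCircle := by
    have h := hbq.norm_rpow_div (ENNReal.ofReal (t / 2))
    rw [ENNReal.toReal_ofReal (by positivity), hqt', ← ENNReal.ofReal_div_of_pos (by positivity),
      show t / (t / 2) = 2 by field_simp, show ENNReal.ofReal 2 = 2 by simp] at h
    refine MemLp.ofReal (f := fun x => b x ^ (t / 2)) ?_
    simpa only [Real.norm_eq_abs, abs_of_pos (hb0 _)] using h
  obtain ⟨h, hhH, hhs, hhc⟩ := exists_outer
    (fun x => Real.one_le_rpow (hb1 x) (by positivity)) hs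
  -- $|k/h|\le b/b^{t/2}=b^{1-t/2}$, which lies in $L^\rho$ because $b\in L^t$.
  have hU : MemLp (fun x => k x / h x) r haarCircle := by
    have h1 := hbq.norm_rpow_div (ENNReal.ofReal (1 - t / 2))
    rw [ENNReal.toReal_ofReal hc.le, hqt', ← ENNReal.ofReal_div_of_pos hc] at h1
    refine h1.mono ((Lp.memLp k).1.aemeasurable.div
      (Lp.memLp h).1.aemeasurable).aestronglyMeasurable ?_
    filter_upwards [hhs] with x hx
    rw [norm_div, hx, Real.norm_eq_abs, Real.norm_eq_abs, abs_of_pos (hb0 x),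
      abs_of_pos (Real.rpow_pos_of_pos (hb0 x) _), Real.rpow_sub (hb0 x), Real.rpow_one]
    gcongr
    exact le_max_right _ _
  set U : Lp ℂ r haarCircle := hU.toLp _ with hUdef
  have hUx : ∀ᵐ x ∂haarCircle, U x = k x / h x := hU.coeFn_toLp
  have hUh : (mulOp U h : Lp ℂ q haarCircle) = k := by
    refine Lp.ext ?_
    filter_upwards [coeFn_mulOp (r := q) U h, hUx, hhs] with x h1 h2 h3
    have hne : h x ≠ 0 := by
      rw [← norm_ne_zero_iff, h3]
      exact (Real.rpow_pos_of_pos (hb0 x) _).ne'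
    rw [h1, h2, div_mul_cancel₀ _ hne]
  have hU1 : (mulOp U (one 2 haarCircle) : Lp ℂ q haarCircle) = incl hq (incl hr2 U) := by
    refine Lp.ext ?_
    filter_upwards [coeFn_mulOp (r := q) U (one 2 haarCircle), coeFn_one 2 haarCircle,
      coeFn_incl hq (incl hr2 U), coeFn_incl hr2 U] with x h1 h2 h3 h4
    rw [h1, h2, h3, h4, mul_one]
  refine ⟨incl hr2 U, fun S hS => ?_⟩
  have hinv : IsInvariant (S.comap
      (mulOp U : Lp ℂ 2 haarCircle →L[ℂ] Lp ℂ q haarCircle).toLinearMap) :=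
    hS.comap _ (mulOp_zmul U 1)
  constructor
  · intro hk
    have h1 := hhc _ hinv (by rwa [Submodule.mem_comap, ContinuousLinearMap.coe_coe, hUh])
    rwa [Submodule.mem_comap, ContinuousLinearMap.coe_coe, hU1] at h1
  · intro hu
    have h1 := hinv.hardySpace_le
      (by rwa [Submodule.mem_comap, ContinuousLinearMap.coe_coe, hU1]) hhH
    rwa [Submodule.mem_comap, ContinuousLinearMap.coe_coe, hUh] at h1

end Outer

/-! ### The Beurling–Helson theorem in $L^p$ -/

section BeurlingHelson

variable {p q : ℝ≥0∞} [Fact (1 ≤ p)] [Fact (1 ≤ q)]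

/-- The annihilator in `L^q` of a subspace of `L^p`, for conjugate exponents. -/
def annihilator [p.HolderConjugate q] (A : Submodule ℂ (Lp ℂ p haarCircle)) :
    Submodule ℂ (Lp ℂ q haarCircle) :=
  ⨅ w : A, ((ContinuousLinearMap.mul ℂ ℂ).lpPairing haarCircle p q w).ker

lemma mem_annihilator_iff [p.HolderConjugate q] {A : Submodule ℂ (Lp ℂ p haarCircle)}
    {b : Lp ℂ q haarCircle} :
    b ∈ annihilator A ↔ ∀ w ∈ A, ∫ x, w x * b x ∂haarCircle = 0 := by
  simp [annihilator, ContinuousLinearMap.lpPairing_eq_integral]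

lemma isInvariant_annihilator [p.HolderConjugate q] {A : Submodule ℂ (Lp ℂ p haarCircle)}
    (hA : ∀ w ∈ A, zmul 1 w ∈ A) : IsInvariant (annihilator A : Submodule ℂ (Lp ℂ q haarCircle)) where
  isClosed := by
    rw [annihilator, Submodule.coe_iInf]
    exact isClosed_iInter fun w => ContinuousLinearMap.isClosed_ker _
  zmul_mem b hb := by
    rw [mem_annihilator_iff] at hb ⊢
    intro w hw
    rw [← hb _ (hA w hw)]
    refine integral_congr_ae ?_
    filter_upwards [coeFn_zmul 1 w, coeFn_zmul 1 b] with x h1 h2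
    rw [h1, h2]
    ring

/-- For $u\in L^2$ the annihilation condition is membership in the kernel of an $L^2$-continuous
functional, so it extends to $L^2$-closures. -/
lemma incl_mem_annihilator_iff [p.HolderConjugate q] (hp : 2 ≤ p) (hq : q ≤ 2)
    {A : Submodule ℂ (Lp ℂ p haarCircle)} {u : Lp ℂ 2 haarCircle} :
    incl hq u ∈ (annihilator A : Submodule ℂ (Lp ℂ q haarCircle)) ↔
      A ≤ (((ContinuousLinearMap.mul ℂ ℂ).lpPairing haarCircle 2 2 u).ker.comap
        (incl hp : Lp ℂ p haarCircle →L[ℂ] Lp ℂ 2 haarCircle).toLinearMap) := by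
  rw [mem_annihilator_iff]
  refine forall₂_congr fun w _ => ?_
  rw [Submodule.mem_comap, ContinuousLinearMap.coe_coe, LinearMap.mem_ker,
    ContinuousLinearMap.coe_coe, ContinuousLinearMap.lpPairing_eq_integral]
  refine Eq.congr_left (integral_congr_ae ?_)
  filter_upwards [coeFn_incl hp w, coeFn_incl hq u] with x h1 h2
  rw [h1, h2, ContinuousLinearMap.mul_apply', mul_comm]

/-- For `p ≤ 2`, invariant subspaces are determined by their members in `L²`. -/
lemma IsInvariant.le_of_incl_mem (hp : p ≤ 2) {M S : Submodule ℂ (Lp ℂ p haarCircle)}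
    (hM : IsInvariant M) (hS : IsInvariant S) (h : ∀ u, incl hp u ∈ M → incl hp u ∈ S) :
    M ≤ S := fun f hf => by
  obtain ⟨u, hu⟩ := exists_L2_generator hp f
  exact (hu S hS).2 (h u ((hu M hM).1 hf))

lemma isInvariant_closure_map_incl (hp : 2 ≤ p) {M : Submodule ℂ (Lp ℂ p haarCircle)}
    (hM : IsInvariant M) : IsInvariant (M.map (incl hp : Lp ℂ p haarCircle →L[ℂ]
      Lp ℂ 2 haarCircle).toLinearMap).topologicalClosure := by
  refine isInvariant_topologicalClosure ?_
  rintro - ⟨w, hw, rfl⟩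
  exact ⟨zmul 1 w, hM.zmul_mem w hw, incl_zmul hp 1 w⟩

/-- For `p ≥ 2`, an invariant subspace is the intersection of `L^p` with its closure in `L²`. -/
lemma IsInvariant.mem_iff_incl_mem_closure (hp : 2 ≤ p) (hpt : p ≠ ∞)
    {M : Submodule ℂ (Lp ℂ p haarCircle)} (hM : IsInvariant M) {f : Lp ℂ p haarCircle} :
    f ∈ M ↔ incl hp f ∈ (M.map (incl hp : Lp ℂ p haarCircle →L[ℂ]
      Lp ℂ 2 haarCircle).toLinearMap).topologicalClosure := by
  refine ⟨fun h => Submodule.le_topologicalClosure _ ⟨f, h, rfl⟩, fun hf => ?_⟩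
  by_contra hfM
  set N := (M.map (incl hp : Lp ℂ p haarCircle →L[ℂ]
      Lp ℂ 2 haarCircle).toLinearMap).topologicalClosure with hN
  have hNinv : IsInvariant N := isInvariant_closure_map_incl hp hM
  have hconj : p.HolderConjugate p.conjExponent :=
    ENNReal.HolderConjugate.conjExponent (Fact.out : 1 ≤ p)
  have : Fact (1 ≤ p.conjExponent) := ⟨ENNReal.HolderConjugate.one_le p.conjExponent p⟩
  have hq : p.conjExponent ≤ 2 := by
    have h1 := hconj.inv_add_inv_eq_inv
    rw [inv_one] at h1
    have h2 : p⁻¹ ≤ 2⁻¹ := ENNReal.inv_le_inv.2 hp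
    rw [← ENNReal.inv_le_inv]
    by_contra hlt
    rw [not_le] at hlt
    have h3 := ENNReal.add_lt_add_of_le_of_lt (ne_top_of_le_ne_top (by simp) h2) h2 hlt
    rw [h1, ENNReal.inv_two_add_inv_two] at h3
    exact lt_irrefl _ h3
  obtain ⟨k, hkq, hkM, hkf⟩ := exists_memLp_annihilating (q := p.conjExponent) hp hpt M
    hM.isClosed f hfM
  have hpair : ∀ w : Lp ℂ p haarCircle, ∫ x, w x * (hkq.toLp k) x ∂haarCircle =
      ∫ x, k x * w x ∂haarCircle := fun w => by
    refine integral_congr_ae ?_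
    filter_upwards [hkq.coeFn_toLp] with x hx
    rw [hx, mul_comm]
  -- Annihilators are invariant, so $k$ and $u$ lie in the same ones: $k$ kills `M`, hence $u$ does,
  -- hence $u$ kills $N\cap L^p$, hence $k$ does too, including $f$.
  obtain ⟨u, hu⟩ := exists_L2_generator hq (hkq.toLp k)
  set A := N.comap (incl hp : Lp ℂ p haarCircle →L[ℂ] Lp ℂ 2 haarCircle).toLinearMap with hA
  have hAinv : IsInvariant A := hNinv.comap _ (incl_zmul hp 1)
  have huM : incl hq u ∈ annihilator M := (hu _ (isInvariant_annihilator hM.zmul_mem)).1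
    (mem_annihilator_iff.2 fun w hw => (hpair w).trans (hkM w hw))
  have huA : incl hq u ∈ annihilator A := by
    rw [incl_mem_annihilator_iff hp hq] at huM ⊢
    refine Submodule.comap_mono (Submodule.topologicalClosure_minimal _ ?_
      (ContinuousLinearMap.isClosed_ker _))
    exact Submodule.map_le_iff_le_comap.2 huM
  have hkA := (hu _ (isInvariant_annihilator hAinv.zmul_mem)).2 huA
  exact hkf ((hpair f).symm.trans (mem_annihilator_iff.1 hkA f hf))

lemma incl_mem_hardySpace (h : p ≤ q) {f : Lp ℂ q haarCircle} (hf : f ∈ hardySpace q haarCircle) :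
    incl h f ∈ hardySpace p haarCircle :=
  (isInvariant_hardySpace.comap (incl h : Lp ℂ q haarCircle →L[ℂ] Lp ℂ p haarCircle)
    (incl_zmul h 1)).hardySpace_le
    (by rw [Submodule.mem_comap, ContinuousLinearMap.coe_coe, incl_one]; exact one_mem_hardySpace) hf

/-- `H² ∩ L^p = H^p` for `p ≥ 2`. -/
lemma incl_mem_hardySpace_two_iff (hp : 2 ≤ p) (hpt : p ≠ ∞) {f : Lp ℂ p haarCircle} :
    incl hp f ∈ hardySpace 2 haarCircle ↔ f ∈ hardySpace p haarCircle := by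
  refine ⟨fun hf => ?_, incl_mem_hardySpace hp⟩
  rw [isInvariant_hardySpace.mem_iff_incl_mem_closure hp hpt]
  refine (isInvariant_closure_map_incl hp isInvariant_hardySpace).hardySpace_le ?_ hf
  exact Submodule.le_topologicalClosure _ ⟨_, one_mem_hardySpace, incl_one hp⟩

lemma incl_injective (h : p ≤ q) :
    Function.Injective (incl h : Lp ℂ q haarCircle →L[ℂ] Lp ℂ p haarCircle) := fun f g hfg => by
  refine Lp.ext ((coeFn_incl h f).symm.trans ?_)
  rw [hfg]
  exact coeFn_incl h g

lemma denseRange_incl (h : p ≤ q) (hpt : p ≠ ∞) :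
    DenseRange (incl h : Lp ℂ q haarCircle →L[ℂ] Lp ℂ p haarCircle) := by
  refine Dense.mono ?_ (ContinuousMap.toLp_denseRange ℂ haarCircle ℂ hpt)
  rintro - ⟨c, rfl⟩
  refine ⟨ContinuousMap.toLp q haarCircle ℂ c, Lp.ext ?_⟩
  exact (coeFn_incl h _).trans ((ContinuousMap.coeFn_toLp haarCircle c).trans
    (ContinuousMap.coeFn_toLp haarCircle c).symm)

/-- The **Beurling–Helson theorem** in `L^p`, `1 ≤ p < ∞`. -/
theorem beurling_helson (hpt : p ≠ ∞) {M : Submodule ℂ (Lp ℂ p haarCircle)} (hM : IsInvariant M) :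
    (∃ φ : Circle → ℂ, IsUnimodular φ ∧
      M = mulSubspace φ Measure.AbsolutelyContinuous.rfl (hardySpace p haarCircle)) ∨
    ∃ E : Set Circle, MeasurableSet E ∧
      M = mulSubspace (E.indicator fun _ => (1 : ℂ)) Measure.AbsolutelyContinuous.rfl
        (⊤ : Submodule ℂ (Lp ℂ p haarCircle)) := by
  rcases le_total p 2 with hp | hp
  · set N := M.comap (incl hp : Lp ℂ 2 haarCircle →L[ℂ] Lp ℂ p haarCircle).toLinearMap with hN
    have hmemN : ∀ u, u ∈ N ↔ incl hp u ∈ M := fun u => by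
      rw [hN, Submodule.mem_comap, ContinuousLinearMap.coe_coe]
    have hNinv : IsInvariant N := hM.comap _ (incl_zmul hp 1)
    rcases beurling_helson_two hNinv with ⟨φ, hφ, hNφ⟩ | ⟨E, hE, hNE⟩
    · refine Or.inl ⟨φ, hφ, le_antisymm ?_ fun f hf => ?_⟩
      · refine hM.le_of_incl_mem hp (isInvariant_mulSubspace_unimodular hφ) fun u hu => ?_
        rw [← hmemN, hNφ, mem_mulSubspace_iff hφ.memLp] at hu
        obtain ⟨h, hh, rfl⟩ := hu
        exact (mem_mulSubspace_iff hφ.memLp).2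
          ⟨incl hp h, incl_mem_hardySpace hp hh, (incl_bmul hp hφ.memLp h).symm⟩
      · obtain ⟨h, hh, rfl⟩ := (mem_mulSubspace_iff hφ.memLp).1 hf
        refine (hM.comap (bmul hφ.memLp : Lp ℂ p haarCircle →L[ℂ] Lp ℂ p haarCircle)
          (bmul_zmul _ 1)).hardySpace_le ?_ hh
        rw [Submodule.mem_comap, ContinuousLinearMap.coe_coe, ← incl_one hp, ← incl_bmul, ← hmemN,
          hNφ]
        exact (mem_mulSubspace_iff hφ.memLp).2 ⟨_, one_mem_hardySpace, rfl⟩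
    · refine Or.inr ⟨E, hE, le_antisymm ?_ fun f hf => ?_⟩
      · refine hM.le_of_incl_mem hp (isInvariant_mulSubspace_indicator hE) fun u hu => ?_
        rw [← hmemN, hNE, mem_mulSubspace_indicator_iff hE] at hu
        rw [mem_mulSubspace_indicator_iff hE, ← incl_bmul, hu]
      · obtain ⟨h, -, rfl⟩ := (mem_mulSubspace_iff (memLp_indicator hE)).1 hf
        -- The $L^2$ theorem gives only $\chi_E L^2\subseteq M$; density of $L^2$ in $L^p$ and
        -- closedness of `M` give the rest.
        refine (denseRange_incl hp hpt).induction_on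
          (p := fun h => bmul (memLp_indicator hE) h ∈ M) h ?_ fun u => ?_
        · exact hM.isClosed.preimage (bmul (memLp_indicator hE)).continuous
        · rw [← incl_bmul, ← hmemN, hNE]
          exact (mem_mulSubspace_iff (memLp_indicator hE)).2 ⟨u, trivial, rfl⟩
  · rcases beurling_helson_two (isInvariant_closure_map_incl hp hM) with
      ⟨φ, hφ, hNφ⟩ | ⟨E, hE, hNE⟩
    · refine Or.inl ⟨φ, hφ, Submodule.ext fun f => ?_⟩
      rw [hM.mem_iff_incl_mem_closure hp hpt, hNφ, mulSubspace_unimodular_eq_comap hφ,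
        mulSubspace_unimodular_eq_comap hφ, Submodule.mem_comap, Submodule.mem_comap,
        ContinuousLinearMap.coe_coe, ContinuousLinearMap.coe_coe, ← incl_bmul,
        incl_mem_hardySpace_two_iff hp hpt]
    · refine Or.inr ⟨E, hE, Submodule.ext fun f => ?_⟩
      rw [hM.mem_iff_incl_mem_closure hp hpt, hNE, mem_mulSubspace_indicator_iff hE,
        mem_mulSubspace_indicator_iff hE, ← incl_bmul, (incl_injective hp).eq_iff]

end BeurlingHelson

/-! ### Transfer from $\mu$ to $\lambda$ -/

section Transfer

variable {p : ℝ≥0∞} {lam : Measure Circle}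

/-- The weight `g^{-1/p}`, where `g` is the density of `lam`. -/
def weight (p : ℝ≥0∞) (lam : Measure Circle) (x : Circle) : ℂ :=
  ((density lam x ^ (-(1 / p.toReal)) : ℝ) : ℂ)

lemma measurable_weight : Measurable (weight p lam) :=
  Complex.measurable_ofReal.comp ((lam.measurable_rnDeriv haarCircle).ennreal_toReal.pow_const _)

lemma density_pos [SigmaFinite lam] (hac : lam ≪ haarCircle) (hca : haarCircle ≪ lam) :
    ∀ᵐ x ∂haarCircle, 0 < density lam x := by
  filter_upwards [hca.ae_le (Measure.rnDeriv_pos hac), lam.rnDeriv_lt_top haarCircle] with x h1 h2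
  exact ENNReal.toReal_pos h1.ne' h2.ne

lemma weight_ne_zero [SigmaFinite lam] (hac : lam ≪ haarCircle) (hca : haarCircle ≪ lam) :
    ∀ᵐ x ∂haarCircle, weight p lam x ≠ 0 := by
  filter_upwards [density_pos hac hca] with x hx
  rw [weight, Complex.ofReal_ne_zero]
  exact (Real.rpow_pos_of_pos hx _).ne'

variable [Fact (1 ≤ p)] [IsProbabilityMeasure lam]

lemma eLpNorm_weight_mul (hp : p ≠ ⊤) (hac : lam ≪ haarCircle) (hca : haarCircle ≪ lam)
    {f : Circle → ℂ} (hf : AEStronglyMeasurable f haarCircle) :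
    eLpNorm (fun x => weight p lam x * f x) p lam = eLpNorm f p haarCircle := by
  have hp0 : p ≠ 0 := (zero_lt_one.trans_le (Fact.out : 1 ≤ p)).ne'
  have hr : 0 < p.toReal := ENNReal.toReal_pos hp0 hp
  rw [eLpNorm_eq_lintegral_rpow_enorm_toReal hp0 hp, eLpNorm_eq_lintegral_rpow_enorm_toReal hp0 hp]
  congr 1
  have hmeas : AEMeasurable (fun x => ‖weight p lam x * f x‖ₑ ^ p.toReal) haarCircle :=
    (measurable_weight.aemeasurable.mul hf.aemeasurable).enorm.pow_const _
  rw [← lintegral_rnDeriv_mul hac hmeas]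
  refine lintegral_congr_ae ?_
  filter_upwards [density_pos hac hca, lam.rnDeriv_lt_top haarCircle] with x h1 h2
  -- The exponent $-1/p$ is chosen so that $|g^{-1/p}|^p$ cancels the density in $d\lambda=g\,d\mu$.
  have hW : ‖weight p lam x‖ₑ ^ p.toReal = (lam.rnDeriv haarCircle x)⁻¹ := by
    have h3 : ‖weight p lam x‖ = density lam x ^ (-(1 / p.toReal)) := by
      rw [weight, Complex.norm_real, Real.norm_eq_abs, abs_of_pos (Real.rpow_pos_of_pos h1 _)]
    rw [← ofReal_norm, h3, ENNReal.ofReal_rpow_of_pos (Real.rpow_pos_of_pos h1 _),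
      ← Real.rpow_mul h1.le, neg_mul, one_div_mul_cancel hr.ne', Real.rpow_neg_one,
      ENNReal.ofReal_inv_of_pos h1, density, ENNReal.ofReal_toReal h2.ne]
  have hne : lam.rnDeriv haarCircle x ≠ 0 := fun h0 => by simp [density, h0] at h1
  rw [enorm_mul, ENNReal.mul_rpow_of_nonneg _ _ hr.le, hW, ← mul_assoc,
    ENNReal.mul_inv_cancel hne h2.ne, one_mul]

lemma memLp_weight_mul (hp : p ≠ ⊤) (hac : lam ≪ haarCircle) (hca : haarCircle ≪ lam)
    (f : Lp ℂ p haarCircle) : MemLp (fun x => weight p lam x * f x) p lam :=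
  ⟨(measurable_weight.aestronglyMeasurable).mul ((Lp.aestronglyMeasurable f).mono_ac hac), by
    rw [eLpNorm_weight_mul hp hac hca (Lp.aestronglyMeasurable f)]
    exact Lp.eLpNorm_lt_top f⟩

/-- Multiplication by `g^{-1/p}` as an isometry of `L^p` of the circle into `L^p(lam)`. -/
def weightLI (hp : p ≠ ⊤) (hac : lam ≪ haarCircle) (hca : haarCircle ≪ lam) :
    Lp ℂ p haarCircle →ₗᵢ[ℂ] Lp ℂ p lam where
  toFun f := (memLp_weight_mul hp hac hca f).toLp _
  map_add' f g := by
    rw [← MemLp.toLp_add]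
    refine MemLp.toLp_congr _ _ ?_
    filter_upwards [hac.ae_le (Lp.coeFn_add f g)] with x hx
    simp only [hx, Pi.add_apply, mul_add]
  map_smul' c f := by
    rw [RingHom.id_apply, ← MemLp.toLp_const_smul]
    refine MemLp.toLp_congr _ _ ?_
    filter_upwards [hac.ae_le (Lp.coeFn_smul c f)] with x hx
    simp only [hx, Pi.smul_apply, smul_eq_mul, mul_left_comm]
  norm_map' f := by
    simp only [LinearMap.coe_mk, AddHom.coe_mk]
    rw [Lp.norm_toLp, eLpNorm_weight_mul hp hac hca (Lp.aestronglyMeasurable f), Lp.norm_def]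

lemma coeFn_weightLI (hp : p ≠ ⊤) (hac : lam ≪ haarCircle) (hca : haarCircle ≪ lam)
    (f : Lp ℂ p haarCircle) :
    weightLI hp hac hca f =ᵐ[lam] fun x => weight p lam x * f x :=
  (memLp_weight_mul hp hac hca f).coeFn_toLp

lemma weightLI_surjective (hp : p ≠ ⊤) (hac : lam ≪ haarCircle) (hca : haarCircle ≪ lam) :
    Function.Surjective (weightLI hp hac hca) := fun h => by
  have hmeas : AEStronglyMeasurable (fun x => (weight p lam x)⁻¹ * h x) haarCircle :=
    measurable_weight.inv.aestronglyMeasurable.mul ((Lp.aestronglyMeasurable h).mono_ac hca)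
  have hWh : (fun x => weight p lam x * ((weight p lam x)⁻¹ * h x)) =ᵐ[lam] h := by
    filter_upwards [hac.ae_le (weight_ne_zero (p := p) hac hca)] with x hx
    rw [mul_inv_cancel_left₀ hx]
  have hmem : MemLp (fun x => (weight p lam x)⁻¹ * h x) p haarCircle := ⟨hmeas, by
    rw [← eLpNorm_weight_mul hp hac hca hmeas, eLpNorm_congr_ae hWh]
    exact Lp.eLpNorm_lt_top h⟩
  refine ⟨hmem.toLp _, Lp.ext ?_⟩
  filter_upwards [coeFn_weightLI hp hac hca (hmem.toLp _), hac.ae_le hmem.coeFn_toLp, hWh]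
    with x h1 h2 h3
  rw [h1, h2, h3]

/-- Multiplication by `g^{-1/p}` as an isometric isomorphism of `L^p` of the circle onto
`L^p(lam)`. -/
def weightEquiv (hp : p ≠ ⊤) (hac : lam ≪ haarCircle) (hca : haarCircle ≪ lam) :
    Lp ℂ p haarCircle ≃ₗᵢ[ℂ] Lp ℂ p lam :=
  LinearIsometryEquiv.ofSurjective (weightLI hp hac hca) (weightLI_surjective hp hac hca)

lemma coeFn_weightEquiv (hp : p ≠ ⊤) (hac : lam ≪ haarCircle) (hca : haarCircle ≪ lam)
    (f : Lp ℂ p haarCircle) :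
    weightEquiv hp hac hca f =ᵐ[lam] fun x => weight p lam x * f x :=
  coeFn_weightLI hp hac hca f

lemma weightedHardy_eq_map (hp : p ≠ ⊤) (hac : lam ≪ haarCircle) (hca : haarCircle ≪ lam) :
    weightedHardy p lam hac =
      (hardySpace p haarCircle).map (weightEquiv hp hac hca).toLinearEquiv.toLinearMap := by
  ext f
  constructor
  · rintro ⟨h, hh, e⟩
    exact ⟨h, hh, Lp.ext ((coeFn_weightEquiv hp hac hca h).trans e.symm)⟩
  · rintro ⟨h, hh, rfl⟩
    exact ⟨h, hh, coeFn_weightEquiv hp hac hca h⟩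

/-- Pointwise multiplications commute. For the converse direction the weight is cancelled, which
requires it to be nonzero almost everywhere. -/
lemma mulSubspace_map_weightEquiv (hp : p ≠ ⊤) (hac : lam ≪ haarCircle) (hca : haarCircle ≪ lam)
    (φ : Circle → ℂ) (S : Submodule ℂ (Lp ℂ p haarCircle)) :
    mulSubspace φ Measure.AbsolutelyContinuous.rfl
        (S.map (weightEquiv hp hac hca).toLinearEquiv.toLinearMap) =
      (mulSubspace φ Measure.AbsolutelyContinuous.rfl S).map
        (weightEquiv hp hac hca).toLinearEquiv.toLinearMap := by
  ext f
  constructor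
  · rintro ⟨-, ⟨h, hh, rfl⟩, e⟩
    obtain ⟨g, rfl⟩ := (weightEquiv hp hac hca).surjective f
    refine ⟨g, ⟨h, hh, ?_⟩, rfl⟩
    filter_upwards [hca.ae_le (coeFn_weightEquiv hp hac hca g),
      hca.ae_le (coeFn_weightEquiv hp hac hca h), hca.ae_le e, weight_ne_zero (p := p) hac hca]
      with x h1 h2 h3 h4
    refine mul_left_cancel₀ h4 ?_
    rw [← h1, h3]
    refine (congr_arg (φ x * ·) h2).trans ?_
    exact mul_left_comm _ _ _
  · rintro ⟨g, ⟨h, hh, e⟩, rfl⟩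
    refine ⟨weightEquiv hp hac hca h, ⟨h, hh, rfl⟩, ?_⟩
    filter_upwards [coeFn_weightEquiv hp hac hca g, coeFn_weightEquiv hp hac hca h, hac.ae_le e]
      with x h1 h2 h3
    rw [h2]
    refine h1.trans ?_
    rw [h3]
    exact mul_left_comm _ _ _

end Transfer

/-- The **Beurling–Helson theorem**, as a characterization. -/
theorem beurling_helson_iff {p : ℝ≥0∞} [Fact (1 ≤ p)] (hp : p ≠ ⊤)
    (M : Submodule ℂ (Lp ℂ p haarCircle)) :
    (IsClosed (M : Set (Lp ℂ p haarCircle)) ∧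
      mulSubspace (fun z : Circle => (z : ℂ)) Measure.AbsolutelyContinuous.rfl M ≤ M) ↔
    ((∃ φ : Circle → ℂ, IsUnimodular φ ∧
      M = mulSubspace φ Measure.AbsolutelyContinuous.rfl (hardySpace p haarCircle)) ∨
    ∃ E : Set Circle, MeasurableSet E ∧
      M = mulSubspace (E.indicator fun _ => (1 : ℂ)) Measure.AbsolutelyContinuous.rfl
        (⊤ : Submodule ℂ (Lp ℂ p haarCircle))) := by
  rw [mulSubspace_coe_le_iff]
  refine ⟨fun h => beurling_helson hp ⟨h.1, h.2⟩, ?_⟩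
  rintro (⟨φ, hφ, rfl⟩ | ⟨E, hE, rfl⟩)
  · exact ⟨(isInvariant_mulSubspace_unimodular hφ).isClosed,
      (isInvariant_mulSubspace_unimodular hφ).zmul_mem⟩
  · exact ⟨(isInvariant_mulSubspace_indicator hE).isClosed,
      (isInvariant_mulSubspace_indicator hE).zmul_mem⟩

end BeurlingCircle

end

theorem mainTheorem7 (p : ENNReal) [Fact (1 ≤ p)] (hp : p ≠ ⊤)
    (lam : MeasureTheory.Measure Circle) [MeasureTheory.IsProbabilityMeasure lam]
    (hac : lam ≪ BeurlingCircle.haarCircle) (hca : BeurlingCircle.haarCircle ≪ lam)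
    (hlog : ∫⁻ x, ENNReal.ofReal |Real.log (BeurlingCircle.density lam x)|
      ∂BeurlingCircle.haarCircle = ⊤)
    (M : Submodule ℂ (MeasureTheory.Lp ℂ p lam)) :
    (IsClosed (M : Set (MeasureTheory.Lp ℂ p lam)) ∧
      BeurlingCircle.mulSubspace (fun z : Circle => (z : ℂ))
        MeasureTheory.Measure.AbsolutelyContinuous.rfl M ≤ M) ↔
    ((∃ φ : Circle → ℂ, BeurlingCircle.IsUnimodular φ ∧
        M = BeurlingCircle.mulSubspace φ MeasureTheory.Measure.AbsolutelyContinuous.rfl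
          (BeurlingCircle.weightedHardy p lam hac)) ∨
      (∃ E : Set Circle, MeasurableSet E ∧
        M = BeurlingCircle.mulSubspace (E.indicator fun _ => (1 : ℂ))
          MeasureTheory.Measure.AbsolutelyContinuous.rfl
          (⊤ : Submodule ℂ (MeasureTheory.Lp ℂ p lam)))) := by
  set T := BeurlingCircle.weightEquiv hp hac hca with hT
  have hinj : Function.Injective (Submodule.map T.toLinearEquiv.toLinearMap) :=
    Submodule.map_injective_of_injective T.injective
  -- Every subspace of $L^p(\lambda)$ is the image of one of $L^p(\mu)$; closedness, invariance and
  -- both normal forms can then be read off before applying `T`.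
  obtain ⟨M, rfl⟩ : ∃ M', Submodule.map T.toLinearEquiv.toLinearMap M' = M :=
    ⟨M.comap T.toLinearEquiv.toLinearMap,
      Submodule.map_comap_eq_of_surjective T.surjective M⟩
  have htop : (⊤ : Submodule ℂ (MeasureTheory.Lp ℂ p lam)) =
      Submodule.map T.toLinearEquiv.toLinearMap ⊤ := by
    rw [Submodule.map_top]
    exact (LinearMap.range_eq_top.2 T.surjective).symm
  have hclosed : IsClosed (Submodule.map T.toLinearEquiv.toLinearMap M :
      Set (MeasureTheory.Lp ℂ p lam)) ↔
      IsClosed (M : Set (MeasureTheory.Lp ℂ p BeurlingCircle.haarCircle)) :=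
    T.toHomeomorph.isClosed_image
  rw [htop, BeurlingCircle.weightedHardy_eq_map hp hac hca, hclosed]
  simp only [hT, BeurlingCircle.mulSubspace_map_weightEquiv hp hac hca]
  rw [Submodule.map_le_map_iff_of_injective T.injective,
    BeurlingCircle.beurling_helson_iff hp M]
  simp only [hT] at hinj
  simp only [hinj.eq_iff]
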